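/- Let $0<q<1$, $\gamma,c\in\mathbb R$ with $\gamma\neq 0$, and $n\ge 0$. Put $[\gamma]_q=\frac{q^{\gamma}-q^{-\gamma}}{q-q^{-1}}$ and fix the principal complex square root $[\gamma]_q^{1/2}$. Let $\mathbf H=\mathbf H^{(\gamma,c)}$ be the complex vector space with basis $h_m$ ($m\ge 0$) and the operators $$\alpha^-h_m=[\gamma]_q^{1/2}m^{1/2}h_{m-1},\quad \alpha^+h_m=[\gamma]_q^{1/2}(m+1)^{1/2}h_{m+1},\quad \epsilon h_m=(m+c)h_m,\quad \Gamma h_m=\gamma h_m .$$ On $\mathbf H\otimes\mathbf H$ put $$\Re=q^{-(\epsilon\otimes\Gamma+\Gamma\otimes\epsilon)}\exp\big[(q-q^{-1})(q^{\Gamma/2}\otimes q^{-\Gamma/2})(\alpha^-\otimes\alpha^+)\big],\qquad \mathcal O=q^{-\Gamma/2}[\Gamma]_q^{-1/2}\alpha^+\otimes[\Gamma]_q^{1/2}-[\Gamma]_q^{1/2}\otimes q^{\Gamma/2}[\Gamma]_q^{-1/2}\alpha^+ ,$$ and let $\mathcal P$ be the flip. On $\mathbf H^{\otimes n}$ let $\sigma_i$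 be $q^{2c\gamma}\,\mathcal P\Re$ in the positions $i,i+1$, let $\mathcal O_i$ be $\mathcal O$ in the positions $i,i+1$ ($1\le i\le n-1$), let $v_0=h_0\otimes\cdots\otimes h_0$ and $w_{i,j}=\mathcal O_i\mathcal O_jv_0$. Let $\mathbf V$ be the space of all $x\in\mathbf H^{\otimes n}$ with $\Delta^{(n)}\epsilon\, x=(nc+2)x$ and $\Delta^{(n)}\alpha^- x=0$, where $\Delta^{(n)}\epsilon=\sum_k 1^{\otimes k-1}\otimes\epsilon\otimes 1^{\otimes n-k}$ and $\Delta^{(n)}\alpha^-=\sum_k (q^{-\Gamma/2})^{\otimes k-1}\otimes\alpha^-\otimes(q^{\Gamma/2})^{\otimes n-k}$. (a) The operators $\sigma_i$ preserve $\mathbf V$ and define a representation of the braid group $B_n$ on $\mathbf V$. One has $w_{i,j}=w_{j,i}$, the vectors $w_{i,j}$ with $1\le i\le j\le n-1$ form a basis of $\mathbf V$, and $\dim\mathbf V=n(n-1)/2$. (b) Whenever all indices lie in $\{1,\dots,n-1\}$ and $j,k\notin\{i-1,i,i+1\}$, \begin{align*} \sigma_i w_{j,k}&=w_{j,k}, &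 \sigma_i w_{i,i}&=q^{-4\gamma}w_{i,i},\\ \sigma_i w_{i,k}&=-q^{-2\gamma}w_{i,k}, & \sigma_i w_{k,i}&=-q^{-2\gamma}w_{k,i},\\ \sigma_i w_{i\pm1,k}&=q^{-\gamma}w_{i,k}+w_{i\pm1,k}, & \sigma_i w_{k,i\pm1}&=q^{-\gamma}w_{k,i}+w_{k,i\pm1},\\ \sigma_i w_{i-1,i}&=-q^{-2\gamma}(w_{i-1,i}+q^{-\gamma}w_{i,i}), & \sigma_i w_{i,i+1}&=-q^{-2\gamma}(w_{i,i+1}+q^{-\gamma}w_{i,i}),\\ \sigma_i w_{i-1,i-1}&=q^{-2\gamma}w_{i,i}+2q^{-\gamma}w_{i-1,i}+w_{i-1,i-1}, & \sigma_i w_{i+1,i+1}&=q^{-2\gamma}w_{i,i}+2q^{-\gamma}w_{i,i+1}+w_{i+1,i+1},\\ \sigma_i w_{i-1,i+1}&=q^{-2\gamma}w_{i,i}+q^{-\gamma}(w_{i-1,i}+w_{i,i+1})+w_{i-1,i+1}. \end{align*} (c) For nonzero parameters $\mathsf q,s$ let $\mathbf W_{n,2}$ be the Jackson–Kerler representation: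 with the generic Verma module of $U_{\mathsf q}(sl_2)$ with basis $v_0,v_1,\dots$, $Ev_j=v_{j-1}$ ($Ev_0=0$), $Kv_j=s\mathsf q^{-2j}v_j$, $\Delta E=E\otimes K+1\otimes E$, it is the kernel of $E$ on the span of the $v_{m_1}\otimes\cdots\otimes v_{m_n}$ with $m_1+\cdots+m_n=2$, and the $i$-th generator of $B_n$ acts in the positions $i,i+1$ by $$v_a\otimes v_b\mapsto s^{-(a+b)}\sum_{k=0}^{a}\mathsf q^{2(a-k)(b+k)+k(k-1)/2}{b+k\brack b}_{\mathsf q}\prod_{r=0}^{k-1}\big(s\mathsf q^{-r-b}-s^{-1}\mathsf q^{r+b}\big)\,v_{b+k}\otimes v_{a-k},$$ where ${b+k\brack b}_{\mathsf q}$ is the symmetric quantum binomial coefficient. Take $\mathsf q=1$ and $s=q^{\gamma}$. Then this is a representation of $B_n$, with basis $W_{i,j}=e_{i,j}-s^{i-j}e_{i,i}-s^{j-i}e_{j,j}$, $1\le i<j\le n$, where $e_{i,j}$ has $v_1$ in the positions $i,j$, $e_{i,i}$ has $v_2$ in the position $i$, and all other factors are $v_0$. There is an isomorphism $\mathbf V\to\mathbf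 W_{n,2}$ of representations of $B_n$ with \begin{align*} w_{i,i}&\mapsto-2W_{i,i+1},\\ w_{i,i+1}&\mapsto s^{-1}W_{i,i+1}-W_{i,i+2}+sW_{i+1,i+2},\\ w_{i,r}&\mapsto-W_{i,r+1}+sW_{i+1,r+1}+s^{-1}W_{i,r}-W_{i+1,r}\qquad(r\ge i+2). \end{align*} (d) $\mathbf V$ is isomorphic, as a representation of $B_n$, to the Lawrence–Krammer–Bigelow representation at the parameters $(Q,t)=(q^{-2\gamma},-1)$. Here the latter is the representation with basis $v_{j,k}$, $1\le j<k\le n$, on which the $i$-th generator acts by $$v_{j,k}\mapsto\begin{cases} v_{j,k}& i\notin\{j-1,j,k-1,k\},\\ Qv_{i,k}+(Q^2-Q)v_{i,j}+(1-Q)v_{j,k}& i=j-1,\\ v_{j+1,k}& i=j\ne k-1,\\ Qv_{j,i}+(1-Q)v_{j,k}-(Q^2-Q)t\,v_{i,k}& i=k-1\ne j,\\ v_{j,k+1}& i=k,\\ -tQ^2v_{j,k}& i=j=k-1. \end{cases}$$ -/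

import Mathlib

open scoped TensorProduct

noncomputable section

/-! ### The braid group -/

/-- The braid relations on the generators `σ_0, …, σ_{n-2}`. -/
def braidRels (n : ℕ) : Set (FreeGroup (Fin (n - 1))) :=
  {r | ∃ i j : Fin (n - 1),
      ((i : ℕ) + 1 < (j : ℕ) ∧
        r = FreeGroup.of i * FreeGroup.of j * (FreeGroup.of j * FreeGroup.of i)⁻¹) ∨
      ((i : ℕ) + 1 = (j : ℕ) ∧
        r = FreeGroup.of i * FreeGroup.of j * FreeGroup.of i *
          (FreeGroup.of j * FreeGroup.of i * FreeGroup.of j)⁻¹)}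

/-- The Artin braid group `B_n` on `n` strands. -/
abbrev BraidGroup (n : ℕ) : Type := PresentedGroup (braidRels n)

/-- The standard generators of `B_n` (counted from `0`). -/
def braidGen {n : ℕ} (i : Fin (n - 1)) : BraidGroup n := PresentedGroup.of i

/-- The left one of the two neighbouring positions on which the `i`-th generator acts. -/
def lft {n : ℕ} (i : Fin (n - 1)) : Fin n := ⟨i, by omega⟩

/-- The right one of the two neighbouring positions on which the `i`-th generator acts. -/
def rgt {n : ℕ} (i : Fin (n - 1)) : Fin n := ⟨i + 1, by omega⟩

/-! ### Tensor powers of a free module with basis `e_0, e_1, …` -/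

/-- The `n`-th tensor power of the free `K`-module with basis indexed by `ℕ`. -/
abbrev TPow (K : Type) [Field K] (n : ℕ) : Type := ⨂[K] _ : Fin n, (ℕ →₀ K)

/-- The basis `e_{m_1} ⊗ ⋯ ⊗ e_{m_n}` of the tensor power. -/
def tBasis (K : Type) [Field K] (n : ℕ) : Module.Basis (Fin n → ℕ) K (TPow K n) :=
  Basis.piTensorProduct fun _ => Finsupp.basisSingleOne

/-- `A` in position `k`, the identity elsewhere. -/
def atSite {K : Type} [Field K] {n : ℕ} (k : Fin n) (A : Module.End K (ℕ →₀ K)) :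
    Module.End K (TPow K n) :=
  PiTensorProduct.map fun j => if j = k then A else LinearMap.id

/-- `1 ⊗ ⋯ ⊗ 1 ⊗ A ⊗ B ⊗ 1 ⊗ ⋯ ⊗ 1` with `A ⊗ B` in the positions `lft i` and `rgt i`. -/
def atPair {K : Type} [Field K] {n : ℕ} (i : Fin (n - 1)) (A B : Module.End K (ℕ →₀ K)) :
    Module.End K (TPow K n) :=
  PiTensorProduct.map fun j => if j = lft i then A else if j = rgt i then B else LinearMap.id

/-- `∑_k L ⊗ ⋯ ⊗ L ⊗ A ⊗ R ⊗ ⋯ ⊗ R` with `A` in the position `k`: the `n`-fold coproduct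
of an element `a` with `Δ a = a ⊗ r + l ⊗ a`, where `r` and `l` are group-like. -/
def skewPrimitive {K : Type} [Field K] (n : ℕ) (L A R : Module.End K (ℕ →₀ K)) :
    Module.End K (TPow K n) :=
  ∑ k : Fin n, PiTensorProduct.map fun j => if j < k then L else if j = k then A else R

/-! ### The quantum oscillator algebra, its representations and its R-matrix -/

namespace HOq

/-- `[γ]_q`. -/
def qNum (q γ : ℝ) : ℝ := (q ^ γ - q ^ (-γ)) / (q - q⁻¹)

/-- `[γ]_q^{1/2}` (principal complex square root). -/
def qNumSqrt (q γ : ℝ) : ℂ := (qNum q γ : ℂ) ^ (1 / 2 : ℂ)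

/-- `α⁻` on the module `H^{(γ,c)}` with basis `h_0, h_1, …`. -/
def alphaMinus (q γ : ℝ) : Module.End ℂ (ℕ →₀ ℂ) :=
  Finsupp.linearCombination ℂ fun m : ℕ =>
    (qNumSqrt q γ * (Real.sqrt m : ℂ)) • Finsupp.single (m - 1) (1 : ℂ)

/-- `α⁺` on `H^{(γ,c)}`. -/
def alphaPlus (q γ : ℝ) : Module.End ℂ (ℕ →₀ ℂ) :=
  Finsupp.linearCombination ℂ fun m : ℕ =>
    (qNumSqrt q γ * (Real.sqrt (m + 1) : ℂ)) • Finsupp.single (m + 1) (1 : ℂ)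

/-- `ε` on `H^{(γ,c)}`. -/
def eps (c : ℝ) : Module.End ℂ (ℕ →₀ ℂ) :=
  Finsupp.linearCombination ℂ fun m : ℕ => ((m : ℂ) + (c : ℂ)) • Finsupp.single m (1 : ℂ)

/-- `Γ` on `H^{(γ,c)}`. -/
def gam (γ : ℝ) : Module.End ℂ (ℕ →₀ ℂ) := (γ : ℂ) • LinearMap.id

/-- `q^{x Γ}` on `H^{(γ,c)}`. -/
def qGam (q γ x : ℝ) : Module.End ℂ (ℕ →₀ ℂ) := ((q ^ (x * γ) : ℝ) : ℂ) • LinearMap.id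

/-- `[Γ]_q^{1/2}` on `H^{(γ,c)}`. -/
def sqrtGam (q γ : ℝ) : Module.End ℂ (ℕ →₀ ℂ) := qNumSqrt q γ • LinearMap.id

/-- `[Γ]_q^{-1/2}` on `H^{(γ,c)}`. -/
def invSqrtGam (q γ : ℝ) : Module.End ℂ (ℕ →₀ ℂ) := (qNumSqrt q γ)⁻¹ • LinearMap.id

/-- `Δ^{(n)} α⁻`, with `Δ α⁻ = α⁻ ⊗ q^{Γ/2} + q^{-Γ/2} ⊗ α⁻`. -/
def coprodAlphaMinus (q γ : ℝ) (n : ℕ) : Module.End ℂ (TPow ℂ n) :=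
  skewPrimitive n (qGam q γ (-1 / 2)) (alphaMinus q γ) (qGam q γ (1 / 2))

/-- `Δ^{(n)} ε`. -/
def coprodEps (c : ℝ) (n : ℕ) : Module.End ℂ (TPow ℂ n) := ∑ k : Fin n, atSite k (eps c)

/-- `Δ^{(n)} Γ`. -/
def coprodGam (γ : ℝ) (n : ℕ) : Module.End ℂ (TPow ℂ n) := ∑ k : Fin n, atSite k (gam γ)

/-- The weight space of `(H^{(γ,c)})^{⊗ n}` for the weights `g` of `Γ` and `e` of `ε`. -/
def weightSpace (γ c : ℝ) (n : ℕ) (g e : ℝ) : Submodule ℂ (TPow ℂ n) :=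
  LinearMap.ker (coprodGam γ n - (g : ℂ) • LinearMap.id) ⊓
    LinearMap.ker (coprodEps c n - (e : ℂ) • LinearMap.id)

/-- The lowest weight space `V^{(e)}` of `(H^{(γ,c)})^{⊗ n}`. -/
def lowestWeightSpace (q γ c : ℝ) (n : ℕ) (e : ℝ) : Submodule ℂ (TPow ℂ n) :=
  weightSpace γ c n (n * γ) e ⊓ LinearMap.ker (coprodAlphaMinus q γ n)

/-- The operator
`𝒪 = q^{-Γ/2} [Γ]^{-1/2} α⁺ ⊗ [Γ]^{1/2} - [Γ]^{1/2} ⊗ q^{Γ/2} [Γ]^{-1/2} α⁺`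
in the positions `lft i` and `rgt i`. -/
def opO (q γ : ℝ) {n : ℕ} (i : Fin (n - 1)) : Module.End ℂ (TPow ℂ n) :=
  atPair i (qGam q γ (-1 / 2) * invSqrtGam q γ * alphaPlus q γ) (sqrtGam q γ) -
    atPair i (sqrtGam q γ) (qGam q γ (1 / 2) * invSqrtGam q γ * alphaPlus q γ)

/-- `v_0 = h_0 ⊗ ⋯ ⊗ h_0`. -/
def v0 (n : ℕ) : TPow ℂ n := tBasis ℂ n 0

/-- `w_{i,j} = 𝒪_i 𝒪_j v_0`. -/
def w (q γ : ℝ) {n : ℕ} (i j : Fin (n - 1)) : TPow ℂ n := opO q γ i (opO q γ j (v0 n))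

/-- `q^{-(ε ⊗ Γ + Γ ⊗ ε)}` in the positions `lft i` and `rgt i`. -/
def cartanPart (q γ c : ℝ) {n : ℕ} (i : Fin (n - 1)) : Module.End ℂ (TPow ℂ n) :=
  (tBasis ℂ n).constr ℂ fun m =>
    ((q ^ (-((m (lft i) + c) * γ + γ * (m (rgt i) + c))) : ℝ) : ℂ) • tBasis ℂ n m

/-- `(q - q⁻¹) (q^{Γ/2} ⊗ q^{-Γ/2}) (α⁻ ⊗ α⁺)` in the positions `lft i` and `rgt i`. -/
def nilPart (q γ : ℝ) {n : ℕ} (i : Fin (n - 1)) : Module.End ℂ (TPow ℂ n) :=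
  ((q : ℂ) - (q : ℂ)⁻¹) •
    (atPair i (qGam q γ (1 / 2)) (qGam q γ (-1 / 2)) *
      atPair i (alphaMinus q γ) (alphaPlus q γ))

/-- The exponential of the locally nilpotent operator `nilPart`: on the basis vector
`h_{m_1} ⊗ ⋯ ⊗ h_{m_n}` the terms of the exponential series of order larger than
`m (lft i)` vanish, because `α⁻` lowers `h_m` to `h_{m-1}` and kills `h_0`. -/
def expNilPart (q γ : ℝ) {n : ℕ} (i : Fin (n - 1)) : Module.End ℂ (TPow ℂ n) :=
  (tBasis ℂ n).constr ℂ fun m =>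
    ∑ k ∈ Finset.range (m (lft i) + 1),
      ((k.factorial : ℂ)⁻¹) • (nilPart q γ i ^ k) (tBasis ℂ n m)

/-- `σ_i = 1 ⊗ ⋯ ⊗ 𝒫 ℜ ⊗ ⋯ ⊗ 1`, where `ℜ` is the R-matrix
`q^{-(ε ⊗ Γ + Γ ⊗ ε)} exp((q - q⁻¹) (q^{Γ/2} ⊗ q^{-Γ/2}) (α⁻ ⊗ α⁺))` and `𝒫` is the flip. -/
def sigma (q γ c : ℝ) {n : ℕ} (i : Fin (n - 1)) : Module.End ℂ (TPow ℂ n) :=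
  (PiTensorProduct.reindex ℂ (fun _ : Fin n => ℕ →₀ ℂ)
      (Equiv.swap (lft i) (rgt i))).toLinearMap ∘ₗ cartanPart q γ c i ∘ₗ expNilPart q γ i

/-- `σ_i` divided by the constant `q^{-2cγ}`, its eigenvalue on `v_0`. -/
def sigmaNorm (q γ c : ℝ) {n : ℕ} (i : Fin (n - 1)) : Module.End ℂ (TPow ℂ n) :=
  ((q ^ (2 * c * γ) : ℝ) : ℂ) • sigma q γ c i

end HOq

/-! ### The Jackson–Kerler representations -/

namespace JK

variable {K : Type} [Field K]

/-- The symmetric quantum binomial coefficient `[n choose k]_q`. -/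
def qBinom (q : K) : ℕ → ℕ → K
  | _, 0 => 1
  | 0, _ + 1 => 0
  | n + 1, k + 1 =>
      q ^ ((k : ℤ) + 1) * qBinom q n (k + 1) + q ^ ((k : ℤ) - n) * qBinom q n k

/-- `E` on the generic Verma module of `U_q(sl_2)`: `E v_j = v_{j-1}` and `E v_0 = 0`. -/
def opE : Module.End K (ℕ →₀ K) :=
  Finsupp.linearCombination K fun j : ℕ => if j = 0 then 0 else Finsupp.single (j - 1) (1 : K)

/-- `K` on the generic Verma module: `K v_j = s q^{-2j} v_j`. -/
def opK (q s : K) : Module.End K (ℕ →₀ K) :=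
  Finsupp.linearCombination K fun j : ℕ =>
    (s * q ^ (-2 * (j : ℤ))) • Finsupp.single j (1 : K)

/-- `E` on the `n`-th tensor power, with `Δ E = E ⊗ K + 1 ⊗ E`. -/
def coprodE (q s : K) (n : ℕ) : Module.End K (TPow K n) :=
  skewPrimitive n LinearMap.id opE (opK q s)

/-- The coefficient of `v_{j+k} ⊗ v_{i-k}` in the image of `v_i ⊗ v_j` under the braiding. -/
def rCoeff (q s : K) (i j k : ℕ) : K :=
  s ^ (-((i : ℤ) + j)) * q ^ (2 * (i - k) * (j + k)) * q ^ (k * (k - 1) / 2) *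
    qBinom q (k + j) j *
    ∏ r ∈ Finset.range k,
      (s * q ^ (-((r : ℤ) + j)) - s⁻¹ * q ^ ((r : ℤ) + j))

/-- The braiding in the positions `lft i` and `rgt i`. -/
def sigma (q s : K) {n : ℕ} (i : Fin (n - 1)) : Module.End K (TPow K n) :=
  (tBasis K n).constr K fun m =>
    ∑ k ∈ Finset.range (m (lft i) + 1),
      rCoeff q s (m (lft i)) (m (rgt i)) k •
        tBasis K n
          (Function.update (Function.update m (lft i) (m (rgt i) + k)) (rgt i) (m (lft i) - k))

/-- `V_{n,l}`, spanned by the `v_{m_1} ⊗ ⋯ ⊗ v_{m_n}` with `m_1 + ⋯ + m_n = l`. -/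
def V (K : Type) [Field K] (n l : ℕ) : Submodule K (TPow K n) :=
  Submodule.span K {x | ∃ m : Fin n → ℕ, ∑ a, m a = l ∧ x = tBasis K n m}

/-- The highest weight space `W_{n,l} = V_{n,l} ∩ ker E`. -/
def W (q s : K) (n l : ℕ) : Submodule K (TPow K n) := V K n l ⊓ LinearMap.ker (coprodE q s n)

/-- The vector `W_{i,j}` of `W_{n,2}` (for `i < j`). With `e_{i,j}` the basis vector that has `v_1`
in the positions `i` and `j`, and `e_{i,i}` the one that has `v_2` in the position `i`, it is
`e_{i,j} - s^{i-j} e_{i,i} - q^{-2} s^{j-i} e_{j,j}`. -/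
def vec (q s : K) {n : ℕ} (i j : Fin n) : TPow K n :=
  tBasis K n (Pi.single i 1 + Pi.single j 1) -
    s ^ ((i : ℤ) - (j : ℤ)) • tBasis K n (Pi.single i 2) -
    (q ^ (-2 : ℤ) * s ^ ((j : ℤ) - (i : ℤ))) • tBasis K n (Pi.single j 2)

end JK

/-! ### The Lawrence–Krammer–Bigelow representation -/

namespace LKB

/-- The index set of the basis `v_{j,k}`, `j < k`. -/
abbrev Idx (n : ℕ) : Type := {p : Fin n × Fin n // p.1 < p.2}

/-- `v_{j,k}`, read as `0` unless `j < k` (which holds wherever it is used). -/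
def v (K : Type) [Field K] {n : ℕ} (j k : Fin n) : Idx n →₀ K :=
  if h : j < k then Finsupp.single ⟨(j, k), h⟩ 1 else 0

/-- The image of `v_{j,k}` under the `i`-th generator, in Bigelow's normalization of the
parameters `q`, `t`; here the generator exchanges the points `a = lft i` and `b = rgt i`. -/
def gen {K : Type} [Field K] (q t : K) {n : ℕ} (i : Fin (n - 1)) (j k : Fin n) : Idx n →₀ K :=
  let a := lft i
  let b := rgt i
  if j = a ∧ k = b then (-t * q ^ 2) • v K j k
  else if j = b then q • v K a k + (q ^ 2 - q) • v K a j + (1 - q) • v K j k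
  else if j = a then v K b k
  else if k = b then q • v K j a + (1 - q) • v K j k - ((q ^ 2 - q) * t) • v K a k
  else if k = a then v K j b
  else v K j k

end LKB

end

/-!
After a rescaling of the basis vectors, both `H^{⊗n}` and the tensor power of the Verma module
become the polynomial ring in `u_1, …, u_n`, and `Δα⁻`, respectively `ΔE`, becomes a multiple of
`∑ ∂/∂u_k`. So `V` and `W_{n,2}` are both the space of translation-invariant quadratic forms. The
exponential in `ℜ` is a Taylor shift `u_i ↦ u_i + κ u_{i+1}`, and the Cartan part followed by the
flip exchanges the two variables up to a factor. Hence `σ_i` acts on polynomials as the algebra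
homomorphism `u_i ↦ (1 - Q) u_i + Q u_{i+1}`, `u_{i+1} ↦ u_i` with `Q = q^{-2γ}`, the Burau
substitution, for which the braid relations are a computation on variables; the action on the
Verma side is the same. Up to scalars, `w_{i,j}` is the product `(u_i - u_{i+1}) (u_j - u_{j+1})`
and `W_{i,j}` is the square `(u_i - u_j)²`, so the change of basis is the polarization identity.
The basis of the Lawrence–Krammer–Bigelow representation consists of the squares of the
differences of the linear forms `(1 - Q) ∑_{l<k} Q^l u_l + Q^k u_k`.
-/

noncomputable section

open MvPolynomial

/-! ### Translation-invariant quadratic forms -/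

section TransInvQuad

variable {σ τ R : Type*} [CommRing R]

variable (σ R) in
/-- The infinitesimal simultaneous translation of all variables: the derivation of the polynomial
ring that sends every variable to `1`. -/
def translation : Derivation R (MvPolynomial σ R) (MvPolynomial σ R) :=
  mkDerivation R 1

variable (σ R) in
/-- The translation-invariant quadratic forms: the homogeneous polynomials of degree two that are
killed by the infinitesimal translation. -/
def transInvQuad : Submodule R (MvPolynomial σ R) :=
  homogeneousSubmodule σ R 2 ⊓ LinearMap.ker (translation σ R).toLinearMap

@[simp] theorem translation_X (k : σ) : translation σ R (X k) = 1 :=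
  mkDerivation_X _ _ _

theorem translation_eq_sum_pderiv [Fintype σ] (p : MvPolynomial σ R) :
    translation σ R p = ∑ k, pderiv k p := by
  classical
  induction p using MvPolynomial.induction_on with
  | C a => simp [← algebraMap_eq]
  | add p r hp hr => simp only [map_add, hp, hr, Finset.sum_add_distrib]
  | mul_X p k hp =>
    simp only [Derivation.leibniz, hp, translation_X, pderiv_X, Finset.sum_add_distrib,
      smul_eq_mul, Finset.mul_sum, Pi.single_apply, mul_ite, mul_zero, Finset.sum_ite_eq,
      Finset.mem_univ, if_true]

theorem sum_X_sub_mul_pderiv [Fintype σ] {p : MvPolynomial σ R} {m : ℕ}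
    (hp : p.IsHomogeneous m) (hp' : translation σ R p = 0) (r : MvPolynomial σ R) :
    ∑ k, (X k - r) * pderiv k p = m • p := by
  simp only [sub_mul, Finset.sum_sub_distrib, hp.sum_X_mul_pderiv, ← Finset.mul_sum,
    ← translation_eq_sum_pderiv, hp', mul_zero, sub_zero]

theorem translation_pderiv (k : σ) (p : MvPolynomial σ R) :
    translation σ R (pderiv k p) = pderiv k (translation σ R p) := by
  have h : ⁅translation σ R, pderiv k⁆ = 0 := derivation_ext fun l => by
    classical
    rw [Derivation.commutator_apply, translation_X, pderiv_X, Derivation.coe_zero, Pi.zero_apply]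
    rcases eq_or_ne k l with rfl | hkl
    · simp
    · simp [Pi.single_eq_of_ne hkl.symm]
  rw [← sub_eq_zero, ← Derivation.commutator_apply, h, Derivation.coe_zero, Pi.zero_apply]

theorem mem_transInvQuad {p : MvPolynomial σ R} :
    p ∈ transInvQuad σ R ↔ p.IsHomogeneous 2 ∧ translation σ R p = 0 :=
  Iff.rfl

theorem mul_mem_transInvQuad {p r : MvPolynomial σ R}
    (hp : p.IsHomogeneous 1) (hp' : translation σ R p = 0)
    (hr : r.IsHomogeneous 1) (hr' : translation σ R r = 0) : p * r ∈ transInvQuad σ R :=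
  mem_transInvQuad.2
    ⟨hp.mul hr, by rw [Derivation.leibniz, hp', hr', smul_zero, smul_zero, add_zero]⟩

theorem isHomogeneous_X_sub_X (j k : σ) : (X j - X k : MvPolynomial σ R).IsHomogeneous 1 :=
  (isHomogeneous_X _ _).sub (isHomogeneous_X _ _)

theorem translation_X_sub_X (j k : σ) : translation σ R (X j - X k) = 0 := by
  rw [map_sub, translation_X, translation_X, sub_self]

theorem sub_mul_sub_mem_transInvQuad (a b c d : σ) :
    (X a - X b) * (X c - X d) ∈ transInvQuad σ R :=
  mul_mem_transInvQuad (isHomogeneous_X_sub_X a b) (translation_X_sub_X a b)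
    (isHomogeneous_X_sub_X c d) (translation_X_sub_X c d)

theorem translation_map {F : MvPolynomial σ R →ₐ[R] MvPolynomial τ R}
    (hF : ∀ k, translation τ R (F (X k)) = 1) (p : MvPolynomial σ R) :
    translation τ R (F p) = F (translation σ R p) := by
  induction p using MvPolynomial.induction_on with
  | C a => simp [← algebraMap_eq]
  | add p r hp hr => simp only [map_add, hp, hr]
  | mul_X p k hp => simp only [map_mul, Derivation.leibniz, hp, hF, translation_X, smul_eq_mul,
      map_add, map_one]

theorem map_mem_transInvQuad {F : MvPolynomial σ R →ₐ[R] MvPolynomial τ R}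
    (hF₁ : ∀ k, (F (X k)).IsHomogeneous 1) (hF₂ : ∀ k, translation τ R (F (X k)) = 1)
    {p : MvPolynomial σ R} (hp : p ∈ transInvQuad σ R) : F p ∈ transInvQuad τ R := by
  refine mem_transInvQuad.2 ⟨?_, by rw [translation_map hF₂, (mem_transInvQuad.1 hp).2, map_zero]⟩
  rw [aeval_unique F]
  exact (mem_transInvQuad.1 hp).1.aeval _ hF₁

end TransInvQuad

section DiffSpan

variable {σ R : Type*} [CommRing R]

/-- The span of the differences of a family of polynomials. -/
def diffSpan (f : σ → MvPolynomial σ R) : Submodule R (MvPolynomial σ R) :=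
  Submodule.span R (Set.range fun p : σ × σ => f p.1 - f p.2)

theorem sub_mem_diffSpan (f : σ → MvPolynomial σ R) (j k : σ) : f j - f k ∈ diffSpan f :=
  Submodule.subset_span ⟨(j, k), rfl⟩

theorem mem_diffSpan_X [Finite σ] {p : MvPolynomial σ R} (hp : p.IsHomogeneous 1)
    (hp' : translation σ R p = 0) : p ∈ diffSpan (X : σ → MvPolynomial σ R) := by
  cases nonempty_fintype σ
  rcases isEmpty_or_nonempty σ with _ | ⟨⟨o⟩⟩
  · rw [← one_smul ℕ p, ← hp.sum_X_mul_pderiv, Finset.univ_eq_empty, Finset.sum_empty]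
    exact zero_mem _
  rw [← one_smul ℕ p, ← sum_X_sub_mul_pderiv hp hp' (X o)]
  refine sum_mem fun k _ => ?_
  have hC : pderiv k p = C (coeff 0 (pderiv k p)) :=
    totalDegree_eq_zero_iff_eq_C.1 ((totalDegree_zero_iff_isHomogeneous σ).2 hp.pderiv)
  rw [hC, mul_comm, ← MvPolynomial.smul_eq_C_mul]
  exact Submodule.smul_mem _ _ (sub_mem_diffSpan X k o)

theorem pderiv_pderiv_sq_X_sub_X [LinearOrder σ] {a b j k : σ}
    (hab : a < b) (hjk : j < k) :
    pderiv a (pderiv b ((X j - X k : MvPolynomial σ R) ^ 2)) =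
      if (j, k) = (a, b) then C (-2) else 0 := by
  have h : ∀ l, pderiv l (X j - X k : MvPolynomial σ R) =
      C ((if j = l then 1 else 0) - if k = l then 1 else 0) := fun l => by
    simp only [map_sub, pderiv_X, Pi.single_apply, apply_ite C, map_one, map_zero]
  rw [sq, Derivation.leibniz, h, smul_eq_mul, ← add_mul, Derivation.leibniz, pderiv_C, smul_zero,
    zero_add, map_add, h, smul_eq_mul, ← C_add, ← C_mul, ← map_zero C, ← apply_ite]
  congr 1
  rcases eq_or_ne j a with rfl | hja
  · rcases eq_or_ne k b with rfl | hkb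
    · norm_num [hjk.ne, hjk.ne']
    · simp [hab.ne, hkb]
  · rcases eq_or_ne k a with rfl | hka
    · simp [(hjk.trans hab).ne, hab.ne, hja]
    · simp [hja, hka]

end DiffSpan

section SquaredDifferences

variable {σ K : Type*} [Field K] [NeZero (2 : K)]

theorem diffSpan_mul_diffSpan_le [LinearOrder σ] (f : σ → MvPolynomial σ K) :
    diffSpan f * diffSpan f ≤
      Submodule.span K (Set.range fun p : {p : σ × σ // p.1 < p.2} => (f p.1.1 - f p.1.2) ^ 2) := by
  set S := Submodule.span K
    (Set.range fun p : {p : σ × σ // p.1 < p.2} => (f p.1.1 - f p.1.2) ^ 2)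
  have hsq : ∀ a b, (f a - f b) ^ 2 ∈ S := fun a b => by
    rcases lt_trichotomy a b with h | rfl | h
    · exact Submodule.subset_span ⟨⟨(a, b), h⟩, rfl⟩
    · simp
    · rw [sub_sq_comm]
      exact Submodule.subset_span ⟨⟨(b, a), h⟩, rfl⟩
  rw [diffSpan, Submodule.span_mul_span, Submodule.span_le, Set.mul_subset_iff]
  rintro _ ⟨⟨a, b⟩, rfl⟩ _ ⟨⟨c, d⟩, rfl⟩
  rw [SetLike.mem_coe, ← Submodule.smul_mem_iff S (two_ne_zero (α := K))]
  have hpol : (2 : K) • ((f a - f b) * (f c - f d)) =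
      (f a - f d) ^ 2 + (f b - f c) ^ 2 - (f a - f c) ^ 2 - (f b - f d) ^ 2 := by
    rw [MvPolynomial.smul_eq_C_mul, map_ofNat]
    ring
  rw [hpol]
  exact sub_mem (sub_mem (add_mem (hsq a d) (hsq b c)) (hsq a c)) (hsq b d)

theorem linearIndependent_sq_X_sub_X [LinearOrder σ] :
    LinearIndependent K fun p : {p : σ × σ // p.1 < p.2} =>
      (X p.1.1 - X p.1.2 : MvPolynomial σ K) ^ 2 := by
  refine linearIndependent_iff'.2 fun s c hc p hp => ?_
  have h : ∑ r ∈ s, c r • (if r.1 = p.1 then C (-2) else 0 : MvPolynomial σ K) = 0 := by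
    have hd := fun r : {p : σ × σ // p.1 < p.2} =>
      pderiv_pderiv_sq_X_sub_X (R := K) p.2 r.2
    simpa only [map_sum, Derivation.map_smul, hd, map_zero, Prod.mk.eta] using
      congrArg (fun x => pderiv p.1.1 (pderiv p.1.2 x)) hc
  simp only [← Subtype.ext_iff, smul_ite, smul_zero, Finset.sum_ite_eq', hp, if_true,
    MvPolynomial.smul_eq_C_mul, ← C_mul, C_eq_zero] at h
  exact (mul_eq_zero.1 h).resolve_right (neg_ne_zero.2 two_ne_zero)

theorem transInvQuad_eq_mul [Finite σ] :
    transInvQuad σ K = diffSpan (X : σ → MvPolynomial σ K) * diffSpan X := by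
  cases nonempty_fintype σ
  refine le_antisymm (fun p hp => ?_) ?_
  · obtain ⟨hp₂, hp₀⟩ := mem_transInvQuad.1 hp
    rw [← Submodule.smul_mem_iff _ (two_ne_zero (α := K)), ofNat_smul_eq_nsmul]
    rcases isEmpty_or_nonempty σ with _ | ⟨⟨o⟩⟩
    · rw [← hp₂.sum_X_mul_pderiv, Finset.univ_eq_empty, Finset.sum_empty]
      exact zero_mem _
    rw [← sum_X_sub_mul_pderiv hp₂ hp₀ (X o)]
    exact sum_mem fun k _ => Submodule.mul_mem_mul (sub_mem_diffSpan X k o)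
      (mem_diffSpan_X hp₂.pderiv (by rw [translation_pderiv, hp₀, map_zero]))
  · rw [diffSpan, Submodule.span_mul_span, Submodule.span_le, Set.mul_subset_iff]
    rintro _ ⟨⟨a, b⟩, rfl⟩ _ ⟨⟨c, d⟩, rfl⟩
    exact sub_mul_sub_mem_transInvQuad a b c d

theorem span_sq_X_sub_X [Finite σ] [LinearOrder σ] :
    Submodule.span K (Set.range fun p : {p : σ × σ // p.1 < p.2} =>
      (X p.1.1 - X p.1.2 : MvPolynomial σ K) ^ 2) = transInvQuad σ K := by
  refine le_antisymm (Submodule.span_le.2 ?_)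
    (transInvQuad_eq_mul.trans_le (diffSpan_mul_diffSpan_le X))
  rintro _ ⟨p, rfl⟩
  simp only [SetLike.mem_coe, sq]
  exact sub_mul_sub_mem_transInvQuad _ _ _ _

variable (σ K) in
/-- The squared differences `(X_j - X_k)²`, `j < k`, as a basis of the translation-invariant
quadratic forms. -/
def sqDiffBasis [Finite σ] [LinearOrder σ] :
    Module.Basis {p : σ × σ // p.1 < p.2} K (transInvQuad σ K) :=
  (Module.Basis.span linearIndependent_sq_X_sub_X).map (LinearEquiv.ofEq _ _ span_sq_X_sub_X)

theorem coe_sqDiffBasis [Finite σ] [LinearOrder σ] (p : {p : σ × σ // p.1 < p.2}) :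
    (sqDiffBasis σ K p : MvPolynomial σ K) = (X p.1.1 - X p.1.2) ^ 2 := by
  rw [sqDiffBasis, Module.Basis.map_apply, LinearEquiv.coe_ofEq_apply, Module.Basis.span_apply]

theorem finrank_transInvQuad [Fintype σ] [LinearOrder σ] :
    Module.finrank K (transInvQuad σ K) = Fintype.card {p : σ × σ // p.1 < p.2} :=
  Module.finrank_eq_card_basis (sqDiffBasis σ K)

/-- A spanning family of the right size as a basis of the translation-invariant quadratic forms. -/
def transInvQuadBasis [Fintype σ] [LinearOrder σ] {ι : Type*} [Fintype ι]
    (hι : Fintype.card ι = Fintype.card {p : σ × σ // p.1 < p.2}) {v : ι → MvPolynomial σ K}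
    (hv : Submodule.span K (Set.range v) = transInvQuad σ K) :
    Module.Basis ι K (transInvQuad σ K) :=
  (Module.Basis.span <| linearIndependent_iff_card_eq_finrank_span.2 <| by
    rw [Set.finrank, hv, finrank_transInvQuad, hι]).map (LinearEquiv.ofEq _ _ hv)

theorem coe_transInvQuadBasis [Fintype σ] [LinearOrder σ] {ι : Type*} [Fintype ι]
    (hι : Fintype.card ι = Fintype.card {p : σ × σ // p.1 < p.2}) {v : ι → MvPolynomial σ K}
    (hv : Submodule.span K (Set.range v) = transInvQuad σ K) (a : ι) :
    (transInvQuadBasis hι hv a : MvPolynomial σ K) = v a := by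
  rw [transInvQuadBasis, Module.Basis.map_apply, LinearEquiv.coe_ofEq_apply,
    Module.Basis.span_apply]

end SquaredDifferences

section Steps

variable {R : Type*} [CommRing R] {n : ℕ}

variable (R) in
/-- The difference of the two variables on which the `i`-th braid generator acts. -/
def stepDiff (i : Fin (n - 1)) : MvPolynomial (Fin n) R := X (lft i) - X (rgt i)

theorem diffSpan_le_of_step_mem {f : Fin n → MvPolynomial (Fin n) R}
    {S : Submodule R (MvPolynomial (Fin n) R)} (h : ∀ i, f (lft i) - f (rgt i) ∈ S) :
    diffSpan f ≤ S := by
  have h0 : ∀ (j k : ℕ) (hj : j < n) (hk : k < n), j ≤ k → f ⟨j, hj⟩ - f ⟨k, hk⟩ ∈ S := by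
    intro j k hj hk hjk
    induction k, hjk using Nat.le_induction with
    | base => simp
    | succ k _ ih =>
      rw [← sub_add_sub_cancel _ (f ⟨k, by omega⟩)]
      exact add_mem (ih _) (h ⟨k, by omega⟩)
  refine Submodule.span_le.2 ?_
  rintro _ ⟨⟨j, k⟩, rfl⟩
  rcases le_total j k with hjk | hjk
  · exact h0 j k j.2 k.2 hjk
  · have hkj := neg_mem (h0 k j k.2 j.2 hjk)
    rwa [neg_sub] at hkj

/-- The pair `i ≤ j` of generators corresponds to the pair `lft i < rgt j` of positions. -/
def stepPairEquiv (n : ℕ) : {p : Fin (n - 1) × Fin (n - 1) // p.1 ≤ p.2} ≃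
    {p : Fin n × Fin n // p.1 < p.2} where
  toFun p := ⟨(lft p.1.1, rgt p.1.2), Nat.lt_succ_of_le p.2⟩
  invFun p := ⟨(⟨p.1.1, by have := p.2; omega⟩, ⟨p.1.2 - 1, by have := p.2; omega⟩), by
    have := p.2
    simp only [Fin.mk_le_mk]
    omega⟩
  left_inv p := rfl
  right_inv p := Subtype.ext <| Prod.ext rfl <| Fin.ext <| by
    have := p.2
    simp only [rgt]
    omega

theorem card_lt_pairs (n : ℕ) :
    Fintype.card {p : Fin n × Fin n // p.1 < p.2} = n * (n - 1) / 2 := by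
  rw [← Fintype.card_congr (stepPairEquiv n), ← Fintype.card_congr Sym2.sortEquiv, Sym2.card,
    Fintype.card_fin, Nat.choose_two_right]
  rcases n with _ | n <;> rfl

end Steps

section StepProducts

variable {K : Type*} [Field K] {n : ℕ} [NeZero (2 : K)]

theorem span_stepDiff_mul_stepDiff :
    Submodule.span K (Set.range fun p : {p : Fin (n - 1) × Fin (n - 1) // p.1 ≤ p.2} =>
      stepDiff K p.1.1 * stepDiff K p.1.2) = transInvQuad (Fin n) K := by
  refine le_antisymm (Submodule.span_le.2 ?_) ?_
  · rintro _ ⟨p, rfl⟩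
    exact sub_mul_sub_mem_transInvQuad _ _ _ _
  have hD : diffSpan (X : Fin n → MvPolynomial (Fin n) K) ≤
      Submodule.span K (Set.range (stepDiff K)) :=
    diffSpan_le_of_step_mem fun i => Submodule.subset_span ⟨i, rfl⟩
  rw [transInvQuad_eq_mul]
  refine (mul_le_mul' hD hD).trans ?_
  rw [Submodule.span_mul_span, Submodule.span_le, Set.mul_subset_iff]
  rintro _ ⟨i, rfl⟩ _ ⟨j, rfl⟩
  rcases le_total i j with h | h
  · exact Submodule.subset_span ⟨⟨(i, j), h⟩, rfl⟩
  · exact Submodule.subset_span ⟨⟨(j, i), h⟩, mul_comm _ _⟩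

variable (K n) in
/-- The products `(X_i - X_{i+1}) (X_j - X_{j+1})`, `i ≤ j`, as a basis of the
translation-invariant quadratic forms. -/
def stepBasis : Module.Basis {p : Fin (n - 1) × Fin (n - 1) // p.1 ≤ p.2} K
    (transInvQuad (Fin n) K) :=
  transInvQuadBasis (Fintype.card_congr (stepPairEquiv n)) span_stepDiff_mul_stepDiff

theorem coe_stepBasis (p : {p : Fin (n - 1) × Fin (n - 1) // p.1 ≤ p.2}) :
    (stepBasis K n p : MvPolynomial (Fin n) K) = stepDiff K p.1.1 * stepDiff K p.1.2 :=
  coe_transInvQuadBasis _ _ p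

end StepProducts

/-! ### The Burau action on polynomials -/

section BraidLift

variable {n : ℕ} {G : Type*} [Group G]

/-- The homomorphism out of the braid group determined by elements that satisfy the braid
relations. -/
def braidLift (f : Fin (n - 1) → G)
    (hcomm : ∀ i j : Fin (n - 1), (i : ℕ) + 1 < j → f i * f j = f j * f i)
    (hbraid : ∀ i j : Fin (n - 1), (i : ℕ) + 1 = j → f i * f j * f i = f j * f i * f j) :
    BraidGroup n →* G :=
  PresentedGroup.toGroup (f := f) <| by
    rintro r ⟨i, j, ⟨hij, rfl⟩ | ⟨hij, rfl⟩⟩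
    · simpa only [map_mul, map_inv, FreeGroup.lift_apply_of, mul_inv_eq_one] using hcomm i j hij
    · simpa only [map_mul, map_inv, FreeGroup.lift_apply_of, mul_inv_eq_one] using hbraid i j hij

theorem braidLift_braidGen (f : Fin (n - 1) → G) (hcomm hbraid) (i : Fin (n - 1)) :
    braidLift f hcomm hbraid (braidGen i) = f i :=
  PresentedGroup.toGroup.of _

end BraidLift

section TransportRep

variable {K G V W : Type*} [CommSemiring K] [Monoid G] [AddCommMonoid V] [AddCommMonoid W]
  [Module K V] [Module K W]

/-- A representation transported along a linear equivalence. -/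
def transportRep (ρ : Representation K G V) (e : V ≃ₗ[K] W) : Representation K G W :=
  (e.conjRingEquiv : Module.End K V →* Module.End K W).comp ρ

theorem transportRep_apply (ρ : Representation K G V) (e : V ≃ₗ[K] W) (g : G) (x : W) :
    transportRep ρ e g x = e (ρ g (e.symm x)) := rfl

/-- The equivalence of a representation with its transport. -/
def transportRepEquiv (ρ : Representation K G V) (e : V ≃ₗ[K] W) : ρ.Equiv (transportRep ρ e) :=
  .mk e fun g => by
    ext x
    simp [transportRep_apply]

/-- Multiplication by a unit as an automorphism of a representation. -/
def unitSMulEquiv (ρ : Representation K G V) (u : Kˣ) : ρ.Equiv ρ :=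
  .mk (LinearEquiv.smulOfUnit u) fun g => LinearMap.ext fun x => ((ρ g).map_smul (u : K) x).symm

end TransportRep

section Burau

variable {R : Type*} [CommRing R] {n : ℕ}

theorem lft_lt_rgt (i : Fin (n - 1)) : lft i < rgt i := Nat.lt_succ_self i

theorem lft_ne_rgt (i : Fin (n - 1)) : lft i ≠ rgt i := (lft_lt_rgt i).ne

/-- The Burau substitution for the `i`-th braid generator. -/
def burau (Q : R) (i : Fin (n - 1)) : MvPolynomial (Fin n) R →ₐ[R] MvPolynomial (Fin n) R :=
  aeval fun k => if k = lft i then C (1 - Q) * X (lft i) + C Q * X (rgt i)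
    else if k = rgt i then X (lft i) else X k

/-- The inverse of the Burau substitution with parameter `Q⁻¹`. -/
def burauInv (Q : R) (i : Fin (n - 1)) : MvPolynomial (Fin n) R →ₐ[R] MvPolynomial (Fin n) R :=
  aeval fun k => if k = lft i then X (rgt i)
    else if k = rgt i then C Q * X (lft i) + C (1 - Q) * X (rgt i) else X k

variable (Q : R) (i : Fin (n - 1))

theorem burau_lft : burau Q i (X (lft i)) = C (1 - Q) * X (lft i) + C Q * X (rgt i) := by
  simp [burau]

theorem burau_rgt : burau Q i (X (rgt i)) = X (lft i) := by
  simp [burau, (lft_ne_rgt i).symm]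

theorem burau_of_ne {k : Fin n} (hl : k ≠ lft i) (hr : k ≠ rgt i) :
    burau Q i (X k) = X k := by
  simp [burau, hl, hr]

@[simp] theorem burau_C (a : R) : burau Q i (C a) = C a := algHom_C _ _

theorem burauInv_lft : burauInv Q i (X (lft i)) = X (rgt i) := by
  simp [burauInv]

theorem burauInv_rgt :
    burauInv Q i (X (rgt i)) = C Q * X (lft i) + C (1 - Q) * X (rgt i) := by
  simp [burauInv, (lft_ne_rgt i).symm]

theorem burauInv_of_ne {k : Fin n} (hl : k ≠ lft i) (hr : k ≠ rgt i) :
    burauInv Q i (X k) = X k := by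
  simp [burauInv, hl, hr]

theorem burau_comp_burauInv {Q Q' : R} (hQ : Q * Q' = 1) :
    (burau Q i).comp (burauInv Q' i) = AlgHom.id R _ := by
  have hC : (C Q * C Q' : MvPolynomial (Fin n) R) = 1 := by rw [← C_mul, hQ, C_1]
  refine algHom_ext fun k => ?_
  rw [AlgHom.comp_apply, AlgHom.id_apply]
  rcases eq_or_ne k (lft i) with rfl | hl
  · rw [burauInv_lft, burau_rgt]
  rcases eq_or_ne k (rgt i) with rfl | hr
  · simp only [burauInv_rgt, map_add, map_mul, burau_lft, burau_rgt, burau_C, map_sub, map_one]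
    linear_combination (X (rgt i) - X (lft i)) * hC
  · rw [burauInv_of_ne Q' i hl hr, burau_of_ne Q i hl hr]

theorem burauInv_comp_burau {Q Q' : R} (hQ : Q * Q' = 1) :
    (burauInv Q' i).comp (burau Q i) = AlgHom.id R _ := by
  have hC : (C Q * C Q' : MvPolynomial (Fin n) R) = 1 := by rw [← C_mul, hQ, C_1]
  refine algHom_ext fun k => ?_
  rw [AlgHom.comp_apply, AlgHom.id_apply]
  rcases eq_or_ne k (lft i) with rfl | hl
  · simp only [burau_lft, map_add, map_mul, burauInv_lft, burauInv_rgt, algHom_C, algebraMap_eq,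
      map_sub, map_one]
    linear_combination (X (lft i) - X (rgt i)) * hC
  rcases eq_or_ne k (rgt i) with rfl | hr
  · rw [burau_rgt, burauInv_lft]
  · rw [burau_of_ne Q i hl hr, burauInv_of_ne Q' i hl hr]

theorem burau_mem_transInvQuad {p : MvPolynomial (Fin n) R} (hp : p ∈ transInvQuad (Fin n) R) :
    burau Q i p ∈ transInvQuad (Fin n) R := by
  refine map_mem_transInvQuad (fun k => ?_) (fun k => ?_) hp
  all_goals
    rcases eq_or_ne k (lft i) with rfl | hl
    on_goal 2 => rcases eq_or_ne k (rgt i) with rfl | hr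
  · rw [burau_lft]
    exact ((isHomogeneous_X _ _).C_mul _).add ((isHomogeneous_X _ _).C_mul _)
  · rw [burau_rgt]
    exact isHomogeneous_X _ _
  · rw [burau_of_ne Q i hl hr]
    exact isHomogeneous_X _ _
  · rw [burau_lft, ← smul_eq_C_mul, ← smul_eq_C_mul, map_add, Derivation.map_smul,
      Derivation.map_smul, translation_X, translation_X, ← add_smul, sub_add_cancel, one_smul]
  · rw [burau_rgt, translation_X]
  · rw [burau_of_ne Q i hl hr, translation_X]

theorem burauInv_mem_transInvQuad {p : MvPolynomial (Fin n) R}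
    (hp : p ∈ transInvQuad (Fin n) R) : burauInv Q i p ∈ transInvQuad (Fin n) R := by
  refine map_mem_transInvQuad (fun k => ?_) (fun k => ?_) hp
  all_goals
    rcases eq_or_ne k (lft i) with rfl | hl
    on_goal 2 => rcases eq_or_ne k (rgt i) with rfl | hr
  · rw [burauInv_lft]
    exact isHomogeneous_X _ _
  · rw [burauInv_rgt]
    exact ((isHomogeneous_X _ _).C_mul _).add ((isHomogeneous_X _ _).C_mul _)
  · rw [burauInv_of_ne Q i hl hr]
    exact isHomogeneous_X _ _
  · rw [burauInv_lft, translation_X]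
  · rw [burauInv_rgt, ← smul_eq_C_mul, ← smul_eq_C_mul, map_add, Derivation.map_smul,
      Derivation.map_smul, translation_X, translation_X, ← add_smul, add_sub_cancel, one_smul]
  · rw [burauInv_of_ne Q i hl hr, translation_X]

variable {i} {j : Fin (n - 1)}

theorem burau_comm (hij : (i : ℕ) + 1 < j) :
    (burau Q i).comp (burau Q j) = (burau Q j).comp (burau Q i) := by
  have hi : ∀ k, k = lft j ∨ k = rgt j → burau Q i (X k) = X k := by
    rintro k hk
    apply burau_of_ne <;> rcases hk with rfl | rfl <;>
      simp only [lft, rgt, ne_eq, Fin.mk.injEq] <;> omega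
  have hj : ∀ k, k = lft i ∨ k = rgt i → burau Q j (X k) = X k := by
    rintro k hk
    apply burau_of_ne <;> rcases hk with rfl | rfl <;>
      simp only [lft, rgt, ne_eq, Fin.mk.injEq] <;> omega
  refine algHom_ext fun k => ?_
  rw [AlgHom.comp_apply, AlgHom.comp_apply]
  rcases eq_or_ne k (lft i) with rfl | hil
  · simp [hj, burau_lft]
  rcases eq_or_ne k (rgt i) with rfl | hir
  · simp [hj, burau_rgt]
  rcases eq_or_ne k (lft j) with rfl | hjl
  · simp [hi, burau_lft]
  rcases eq_or_ne k (rgt j) with rfl | hjr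
  · simp [hi, burau_rgt]
  · rw [burau_of_ne Q i hil hir, burau_of_ne Q j hjl hjr, burau_of_ne Q i hil hir]

theorem burau_braid (hij : (i : ℕ) + 1 = j) :
    (burau Q i).comp ((burau Q j).comp (burau Q i)) =
      (burau Q j).comp ((burau Q i).comp (burau Q j)) := by
  have hm : lft j = rgt i := Fin.ext hij.symm
  have hi : burau Q i (X (rgt j)) = X (rgt j) := by
    apply burau_of_ne <;> simp only [lft, rgt, ne_eq, Fin.mk.injEq] <;> omega
  have hj : burau Q j (X (lft i)) = X (lft i) := by
    apply burau_of_ne <;> simp only [lft, rgt, ne_eq, Fin.mk.injEq] <;> omega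
  have hjl : burau Q j (X (rgt i)) = C (1 - Q) * X (rgt i) + C Q * X (rgt j) :=
    hm ▸ burau_lft Q j
  have hjr : burau Q j (X (rgt j)) = X (rgt i) := hm ▸ burau_rgt Q j
  refine algHom_ext fun k => ?_
  simp only [AlgHom.comp_apply]
  rcases eq_or_ne k (lft i) with rfl | hil
  · simp only [burau_lft, burau_rgt, hi, hj, hjl, map_add, map_mul, burau_C, map_sub, map_one]
    ring
  rcases eq_or_ne k (rgt i) with rfl | hir
  · simp only [burau_lft, burau_rgt, hi, hj, hjl, hjr, map_add, map_mul, burau_C]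
  rcases eq_or_ne k (rgt j) with rfl | hjr'
  · simp only [burau_rgt, hi, hj, hjr]
  · rw [burau_of_ne Q i hil hir, burau_of_ne Q j (hm ▸ hir) hjr', burau_of_ne Q i hil hir,
      burau_of_ne Q j (hm ▸ hir) hjr']

end Burau

section QuadRep

variable {R : Type*} [CommRing R] {n : ℕ} (Q : Rˣ)

/-- The action of the `i`-th braid generator on the translation-invariant quadratic forms. -/
def quadGen (i : Fin (n - 1)) : transInvQuad (Fin n) R ≃ₗ[R] transInvQuad (Fin n) R :=
  LinearEquiv.ofLinearMap
    ((burau (Q : R) i).toLinearMap.restrict fun _ hp => burau_mem_transInvQuad _ i hp)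
    ((burauInv (↑Q⁻¹ : R) i).toLinearMap.restrict fun _ hp => burauInv_mem_transInvQuad _ i hp)
    (LinearMap.ext fun p => Subtype.ext (AlgHom.congr_fun (burau_comp_burauInv i Q.mul_inv) p))
    (LinearMap.ext fun p => Subtype.ext (AlgHom.congr_fun (burauInv_comp_burau i Q.mul_inv) p))

variable (n) in
/-- The representation of the braid group on the translation-invariant quadratic forms: the
symmetric square of the reduced Burau representation. -/
def quadRep : Representation R (BraidGroup n) (transInvQuad (Fin n) R) :=
  LinearEquiv.automorphismGroup.toLinearMapMonoidHom.comp <| braidLift (quadGen Q)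
    (fun _ _ hij => LinearEquiv.ext fun p => Subtype.ext <|
      AlgHom.congr_fun (burau_comm (Q : R) hij) p)
    (fun _ _ hij => LinearEquiv.ext fun p => Subtype.ext <|
      AlgHom.congr_fun (burau_braid (Q : R) hij) p)

theorem coe_quadRep_braidGen (i : Fin (n - 1)) (p : transInvQuad (Fin n) R) :
    (quadRep n Q (braidGen i) p : MvPolynomial (Fin n) R) = burau (Q : R) i p := by
  rw [quadRep, MonoidHom.comp_apply, braidLift_braidGen]
  rfl

end QuadRep

/-! ### Forks and the Lawrence–Krammer–Bigelow representation -/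

section Fork

variable {R : Type*} [CommRing R] {n : ℕ} (Q : R)

/-- The linear forms `(1 - Q) ∑_{l < k} Q^l X_l + Q^k X_k`, whose squared differences behave under
the braid generators like the forks of Krammer and Bigelow. -/
def fork (k : Fin n) : MvPolynomial (Fin n) R :=
  C (1 - Q) * ∑ l ∈ Finset.Iio k, C (Q ^ (l : ℕ)) * X l + C (Q ^ (k : ℕ)) * X k

theorem isHomogeneous_fork (k : Fin n) : (fork Q k).IsHomogeneous 1 :=
  ((IsHomogeneous.sum _ _ _ fun l _ => (isHomogeneous_X _ l).C_mul _).C_mul _).add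
    ((isHomogeneous_X _ k).C_mul _)

theorem translation_fork (k : Fin n) : translation (Fin n) R (fork Q k) = 1 := by
  have hsum : ∑ l ∈ Finset.Iio k, Q ^ (l : ℕ) = ∑ l ∈ Finset.range k, Q ^ l := by
    rw [← Nat.Iio_eq_range, ← Fin.map_valEmbedding_Iio, Finset.sum_map]
    rfl
  simp only [fork, ← smul_eq_C_mul, map_add, Derivation.map_smul, map_sum, translation_X]
  rw [← Finset.sum_smul, hsum, smul_smul, mul_neg_geom_sum, ← add_smul, sub_add_cancel, one_smul]

theorem sq_fork_sub_fork_mem (j k : Fin n) :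
    (fork Q j - fork Q k) ^ 2 ∈ transInvQuad (Fin n) R := by
  have h₁ := (isHomogeneous_fork Q j).sub (isHomogeneous_fork Q k)
  have h₀ : translation (Fin n) R (fork Q j - fork Q k) = 0 := by
    rw [map_sub, translation_fork, translation_fork, sub_self]
  rw [sq]
  exact mul_mem_transInvQuad h₁ h₀ h₁ h₀

variable (i : Fin (n - 1))

theorem Iio_rgt : Finset.Iio (rgt i) = insert (lft i) (Finset.Iio (lft i)) := by
  ext l
  simp only [Finset.mem_Iio, Finset.mem_insert, Fin.lt_def, Fin.ext_iff, lft, rgt]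
  omega

theorem fork_rgt : fork Q (rgt i) = C (1 - Q) * ∑ l ∈ Finset.Iio (lft i), C (Q ^ (l : ℕ)) * X l +
    C (Q ^ (i : ℕ)) * (C (1 - Q) * X (lft i) + C Q * X (rgt i)) := by
  rw [fork, Iio_rgt, Finset.sum_insert (by simp)]
  simp only [lft, rgt, pow_succ, C_mul]
  ring

theorem fork_lft_sub_fork_rgt :
    fork Q (lft i) - fork Q (rgt i) = C (Q ^ ((i : ℕ) + 1)) * stepDiff R i := by
  rw [fork_rgt, fork, stepDiff]
  simp only [lft, rgt, pow_succ, C_mul, map_sub, map_one]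
  ring

theorem burau_sum_pow_mul_X {s : Finset (Fin n)} (hs : lft i ∈ s ↔ rgt i ∈ s) :
    burau Q i (∑ l ∈ s, C (Q ^ (l : ℕ)) * X l) = ∑ l ∈ s, C (Q ^ (l : ℕ)) * X l := by
  have hfix : ∀ {s : Finset (Fin n)}, lft i ∉ s → rgt i ∉ s →
      burau Q i (∑ l ∈ s, C (Q ^ (l : ℕ)) * X l) = ∑ l ∈ s, C (Q ^ (l : ℕ)) * X l :=
    fun hl hr => by
      rw [map_sum]
      refine Finset.sum_congr rfl fun l h => ?_
      rw [map_mul, burau_C,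
        burau_of_ne Q i (ne_of_mem_of_not_mem h hl) (ne_of_mem_of_not_mem h hr)]
  by_cases hl : lft i ∈ s
  · have hr : rgt i ∈ s.erase (lft i) := Finset.mem_erase.2 ⟨(lft_ne_rgt i).symm, hs.1 hl⟩
    rw [← Finset.add_sum_erase s _ hl, ← Finset.add_sum_erase _ _ hr, map_add, map_add,
      hfix (by simp) (by simp), map_mul, map_mul, burau_lft, burau_rgt, burau_C, burau_C]
    simp only [lft, rgt, pow_succ, C_mul, map_sub, map_one]
    ring
  · exact hfix hl (hs.not.1 hl)

theorem burau_fork_lft : burau Q i (fork Q (lft i)) = fork Q (rgt i) := by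
  rw [fork, map_add, map_mul, map_mul, burau_sum_pow_mul_X Q i (by simp [(lft_lt_rgt i).le]),
    burau_C, burau_C, burau_lft, fork_rgt]
  rfl

theorem burau_fork_rgt :
    burau Q i (fork Q (rgt i)) = C Q * fork Q (lft i) + C (1 - Q) * fork Q (rgt i) := by
  rw [fork_rgt, fork]
  simp only [map_add, map_mul, burau_C, burau_lft, burau_rgt,
    burau_sum_pow_mul_X Q i (s := Finset.Iio (lft i)) (by simp [(lft_lt_rgt i).le])]
  simp only [lft, map_sub, map_one]
  ring

theorem burau_fork_of_ne {k : Fin n} (hl : k ≠ lft i) (hr : k ≠ rgt i) :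
    burau Q i (fork Q k) = fork Q k := by
  rw [fork, map_add, map_mul, map_mul, burau_sum_pow_mul_X, burau_C, burau_C,
    burau_of_ne Q i hl hr]
  simp only [Finset.mem_Iio, Fin.lt_def, ne_eq, Fin.ext_iff, lft, rgt] at hl hr ⊢
  omega

end Fork

section LKBRep

variable {K : Type*} [Field K] [NeZero (2 : K)] {n : ℕ} (Q : Kˣ)

theorem span_sq_fork_sub_fork :
    Submodule.span K (Set.range fun p : LKB.Idx n => (fork (Q : K) p.1.1 - fork (Q : K) p.1.2) ^ 2)
      = transInvQuad (Fin n) K := by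
  refine le_antisymm (Submodule.span_le.2 ?_) ?_
  · rintro _ ⟨p, rfl⟩
    exact sq_fork_sub_fork_mem _ _ _
  have hX : diffSpan (X : Fin n → MvPolynomial (Fin n) K) ≤ diffSpan (fork (Q : K)) :=
    diffSpan_le_of_step_mem fun i => by
      have h := sub_mem_diffSpan (fork (Q : K)) (lft i) (rgt i)
      rwa [fork_lft_sub_fork_rgt, ← smul_eq_C_mul,
        Submodule.smul_mem_iff _ (pow_ne_zero _ Q.ne_zero)] at h
  rw [transInvQuad_eq_mul]
  exact (mul_le_mul' hX hX).trans (diffSpan_mul_diffSpan_le _)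

/-- The squared differences of forks as a basis of the translation-invariant quadratic forms. -/
def forkBasis : Module.Basis (LKB.Idx n) K (transInvQuad (Fin n) K) :=
  transInvQuadBasis rfl (span_sq_fork_sub_fork Q)

variable (n) in
/-- The representation of the braid group on quadratic forms, in the coordinates of `forkBasis`. -/
def lkbRep : Representation K (BraidGroup n) (LKB.Idx n →₀ K) :=
  transportRep (quadRep n Q) (forkBasis Q).repr

end LKBRep

section LKBGen

variable {K : Type} [Field K] [NeZero (2 : K)] {n : ℕ} (Q : Kˣ)

theorem coe_forkBasis_repr_symm_v {j k : Fin n} (h : j < k) :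
    ((forkBasis Q).repr.symm (LKB.v K j k) : MvPolynomial (Fin n) K) =
      (fork (Q : K) j - fork (Q : K) k) ^ 2 := by
  rw [LKB.v, dif_pos h, Module.Basis.repr_symm_single_one, forkBasis, coe_transInvQuadBasis]

theorem coe_forkBasis_repr_symm_gen (i : Fin (n - 1)) {j k : Fin n} (hjk : j < k) :
    ((forkBasis Q).repr.symm (LKB.gen (Q : K) (-1) i j k) : MvPolynomial (Fin n) K) =
      burau (Q : K) i ((fork (Q : K) j - fork (Q : K) k) ^ 2) := by
  have hlr := lft_lt_rgt i
  have of_ne := fun {k : Fin n} => burau_fork_of_ne (Q : K) i (k := k)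
  simp only [LKB.gen, map_pow, map_sub (burau (Q : K) i)]
  split_ifs with hlr' hjr hjl hkr hkl
  · obtain ⟨rfl, rfl⟩ := hlr'
    rw [burau_fork_lft, burau_fork_rgt, map_smul, Submodule.coe_smul,
      coe_forkBasis_repr_symm_v Q hlr]
    simp only [smul_eq_C_mul, map_mul, map_neg, map_sub, map_one, map_pow]
    ring
  · subst hjr
    rw [burau_fork_rgt, of_ne (hlr.trans hjk).ne' hjk.ne']
    simp only [map_add, map_smul, Submodule.coe_add, Submodule.coe_smul,
      coe_forkBasis_repr_symm_v Q (hlr.trans hjk), coe_forkBasis_repr_symm_v Q hlr,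
      coe_forkBasis_repr_symm_v Q hjk, smul_eq_C_mul, map_sub, map_one, map_pow]
    ring
  · subst hjl
    have hk : k ≠ rgt i := fun hk => hlr' ⟨rfl, hk⟩
    rw [burau_fork_lft, of_ne hjk.ne' hk, coe_forkBasis_repr_symm_v Q]
    simp only [Fin.lt_def, ne_eq, Fin.ext_iff, lft, rgt] at hjk hk ⊢
    omega
  · subst hkr
    have hjl' : j < lft i := by
      simp only [Fin.lt_def, Fin.ext_iff, lft, rgt] at hjk hjl ⊢
      omega
    rw [burau_fork_rgt, of_ne hjl hjk.ne]
    simp only [map_add, map_sub, map_smul, Submodule.coe_add, Submodule.coe_sub,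
      Submodule.coe_smul, coe_forkBasis_repr_symm_v Q hjl', coe_forkBasis_repr_symm_v Q hlr,
      coe_forkBasis_repr_symm_v Q hjk, smul_eq_C_mul, map_mul, map_neg, map_one, map_pow]
    ring
  · subst hkl
    rw [burau_fork_lft, of_ne hjl (hjk.trans hlr).ne, coe_forkBasis_repr_symm_v Q (hjk.trans hlr)]
  · rw [of_ne hjl hjr, of_ne hkl hkr, coe_forkBasis_repr_symm_v Q hjk]

theorem lkbRep_braidGen (i : Fin (n - 1)) {j k : Fin n} (hjk : j < k) :
    lkbRep n Q (braidGen i) (LKB.v K j k) = LKB.gen (Q : K) (-1) i j k := by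
  refine (forkBasis Q).repr.symm.injective (Subtype.ext ?_)
  rw [lkbRep, transportRep_apply, LinearEquiv.symm_apply_apply, coe_quadRep_braidGen,
    coe_forkBasis_repr_symm_v Q hjk, coe_forkBasis_repr_symm_gen Q i hjk]

end LKBGen

/-! ### The polynomial model of a tensor power -/

section TensorPower

variable {K : Type} [Field K] {n : ℕ}

theorem tBasis_eq_tprod (m : Fin n → ℕ) :
    tBasis K n m = PiTensorProduct.tprod K fun j => Finsupp.single (m j) (1 : K) := by
  simp [tBasis, Basis.piTensorProduct_apply]

theorem reindex_tBasis (e : Equiv.Perm (Fin n)) (m : Fin n → ℕ) :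
    PiTensorProduct.reindex K (fun _ => ℕ →₀ K) e (tBasis K n m) = tBasis K n (m ∘ e.symm) := by
  rw [tBasis_eq_tprod, tBasis_eq_tprod]
  exact PiTensorProduct.reindex_tprod _ _

theorem piTensorProduct_map_smul (c : Fin n → K) (f : Fin n → Module.End K (ℕ →₀ K)) :
    PiTensorProduct.map (fun j => c j • f j) = (∏ j, c j) • PiTensorProduct.map f :=
  (PiTensorProduct.mapMultilinear K (fun _ : Fin n => ℕ →₀ K) fun _ => ℕ →₀ K).map_smul_univ c f

theorem atSite_smul (k : Fin n) (c : K) (A : Module.End K (ℕ →₀ K)) :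
    atSite k (c • A) = c • atSite k A := by
  have h := piTensorProduct_map_smul (fun j => if j = k then c else 1)
    fun j => if j = k then A else LinearMap.id
  rw [Finset.prod_ite_eq' Finset.univ k fun _ => c, if_pos (Finset.mem_univ k)] at h
  rw [atSite, atSite, ← h]
  congr 1
  funext j
  split_ifs <;> simp

theorem atSite_id (k : Fin n) : atSite k (LinearMap.id : Module.End K (ℕ →₀ K)) = 1 := by
  simp [atSite, PiTensorProduct.map_id, Module.End.one_eq_id]

theorem atSite_tBasis {k : Fin n} {A : Module.End K (ℕ →₀ K)} {m : Fin n → ℕ} {a : ℕ} {c : K}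
    (hA : A (Finsupp.single (m k) 1) = c • Finsupp.single a 1) :
    atSite k A (tBasis K n m) = c • tBasis K n (Function.update m k a) := by
  have hfactor : ∀ j, (if j = k then A else LinearMap.id) (Finsupp.single (m j) (1 : K)) =
      (if j = k then c else 1) • Finsupp.single (Function.update m k a j) 1 := by
    intro j
    by_cases hj : j = k
    · subst hj
      simpa using hA
    · simp [hj]
  rw [tBasis_eq_tprod, atSite, PiTensorProduct.map_tprod]
  simp only [hfactor]
  rw [MultilinearMap.map_smul_univ, Finset.prod_ite_eq' Finset.univ k fun _ => c,
    if_pos (Finset.mem_univ k), tBasis_eq_tprod]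

theorem atPair_eq_mul (i : Fin (n - 1)) (A B : Module.End K (ℕ →₀ K)) :
    atPair i A B = atSite (lft i) A * atSite (rgt i) B := by
  rw [atPair, atSite, atSite, ← PiTensorProduct.map_mul]
  congr 1
  funext j
  by_cases hj : j = lft i
  · subst hj
    simp only [if_true, lft_ne_rgt i, if_false]
    rfl
  · simp only [hj, if_false]
    rfl

theorem skewPrimitive_smul_id (l r : K) (A : Module.End K (ℕ →₀ K)) :
    skewPrimitive n (l • LinearMap.id) A (r • LinearMap.id) =
      ∑ k : Fin n, (l ^ (k : ℕ) * r ^ (n - 1 - (k : ℕ))) • atSite k A := by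
  refine Finset.sum_congr rfl fun k _ => ?_
  have hprod : (∏ j : Fin n, if j < k then l else if j = k then 1 else r) =
      l ^ (k : ℕ) * r ^ (n - 1 - (k : ℕ)) := by
    have hlt : (Finset.univ.filter fun j : Fin n => j < k) = Finset.Iio k := by ext; simp
    have hgt : (Finset.univ.filter fun j : Fin n => ¬ j < k ∧ ¬ j = k) = Finset.Ioi k := by
      ext j
      simp only [Finset.mem_filter, Finset.mem_univ, true_and, Finset.mem_Ioi]
      omega
    rw [Finset.prod_ite, Finset.prod_const, Finset.prod_ite, Finset.prod_const,
      Finset.prod_const, one_pow, one_mul, Finset.filter_filter, hlt, hgt, Fin.card_Iio,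
      Fin.card_Ioi]
  rw [← hprod, atSite, ← piTensorProduct_map_smul]
  congr 1
  funext j
  split_ifs with hlt heq
  · exact absurd heq hlt.ne
  all_goals simp

end TensorPower

section PolyModel

variable {K : Type} [Field K] {n : ℕ} (t : Kˣ) (ψ : ℕ → Kˣ)

/-- The normalization of the basis vector `e_a` in the position `k`: the factor `ψ a` turns a
lowering operator into a derivative, the power of `t` absorbs the twist of its coproduct. -/
def siteWeight (k : Fin n) (a : ℕ) : Kˣ := t ^ ((k : ℕ) * a) * ψ a

/-- The monomial that stands for the basis vector `e_a` in the position `k`. -/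
def siteMonomial (k : Fin n) (a : ℕ) : MvPolynomial (Fin n) K :=
  C (siteWeight t ψ k a : K) * X k ^ a

/-- The identification of a tensor power with a polynomial ring in the variables `u_k` that sends
`e_{m_1} ⊗ ⋯ ⊗ e_{m_n}` to the product of the `t^{k m_k} ψ(m_k) u_k^{m_k}`. -/
def polyModel : TPow K n ≃ₗ[K] MvPolynomial (Fin n) K :=
  (tBasis K n).equiv
    ((basisMonomials (Fin n) K).unitsSMul fun d => ∏ k, siteWeight t ψ k (d k))
    Finsupp.equivFunOnFinite.symm

theorem polyModel_tBasis_eq_monomial (m : Fin n → ℕ) :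
    polyModel t ψ (tBasis K n m) = monomial (Finsupp.equivFunOnFinite.symm m)
      ((∏ k, siteWeight t ψ k (m k) : Kˣ) : K) := by
  rw [polyModel, Module.Basis.equiv_apply, Module.Basis.unitsSMul_apply, coe_basisMonomials,
    Units.smul_def, smul_monomial]
  simp

theorem polyModel_tBasis (m : Fin n → ℕ) :
    polyModel t ψ (tBasis K n m) = ∏ k, siteMonomial t ψ k (m k) := by
  simp only [siteMonomial, Finset.prod_mul_distrib, ← map_prod]
  rw [polyModel_tBasis_eq_monomial, monomial_eq, Finsupp.prod_fintype _ _ fun _ => pow_zero _,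
    Units.coe_prod]
  rfl

theorem polyModel_tBasis_update (k : Fin n) (m : Fin n → ℕ) (a : ℕ) :
    polyModel t ψ (tBasis K n (Function.update m k a)) =
      siteMonomial t ψ k a * ∏ j ∈ Finset.univ.erase k, siteMonomial t ψ j (m j) := by
  rw [polyModel_tBasis, ← Finset.mul_prod_erase _ _ (Finset.mem_univ k), Function.update_self]
  congr 1
  exact Finset.prod_congr rfl fun j hj => by
    rw [Function.update_of_ne (Finset.ne_of_mem_erase hj)]

theorem polyModel_tBasis_eq_mul (k : Fin n) (m : Fin n → ℕ) :
    polyModel t ψ (tBasis K n m) =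
      siteMonomial t ψ k (m k) * ∏ j ∈ Finset.univ.erase k, siteMonomial t ψ j (m j) := by
  rw [← polyModel_tBasis_update, Function.update_eq_self]

theorem coeff_polyModel (x : TPow K n) (d : Fin n →₀ ℕ) :
    coeff d (polyModel t ψ x) =
      ((∏ k, siteWeight t ψ k (d k) : Kˣ) : K) * (tBasis K n).repr x d := by
  suffices h : lcoeff K d ∘ₗ (polyModel t ψ).toLinearMap =
      ((∏ k, siteWeight t ψ k (d k) : Kˣ) : K) • (tBasis K n).coord d from
    LinearMap.congr_fun h x
  refine (tBasis K n).ext fun m => ?_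
  simp only [LinearMap.comp_apply, LinearEquiv.coe_coe, lcoeff_apply, LinearMap.smul_apply,
    Module.Basis.coord_apply, Module.Basis.repr_self, polyModel_tBasis_eq_monomial, coeff_monomial,
    Finsupp.single_apply, smul_eq_mul]
  rcases eq_or_ne m d with rfl | h
  · simp
  · rw [if_neg h, if_neg, mul_zero]
    rintro rfl
    exact h rfl

theorem mem_V_iff {l : ℕ} {x : TPow K n} :
    x ∈ JK.V K n l ↔ ∀ m : Fin n → ℕ, ∑ k, m k ≠ l → (tBasis K n).repr x m = 0 := by
  have himage : {x | ∃ m : Fin n → ℕ, ∑ a, m a = l ∧ x = tBasis K n m} =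
      tBasis K n '' {m | ∑ a, m a = l} := by
    ext x
    simp [eq_comm]
  rw [JK.V, himage, Module.Basis.mem_span_image]
  simp only [Set.subset_def, Finset.mem_coe, Finsupp.mem_support_iff, Set.mem_ofPred_eq]
  exact forall_congr' fun m => not_imp_comm

theorem isHomogeneous_polyModel {l : ℕ} {x : TPow K n} :
    (polyModel t ψ x).IsHomogeneous l ↔ x ∈ JK.V K n l := by
  have hcoeff (d : Fin n →₀ ℕ) : coeff d (polyModel t ψ x) = 0 ↔ (tBasis K n).repr x d = 0 := by
    rw [coeff_polyModel, Units.mul_right_eq_zero]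
  rw [mem_V_iff]
  constructor
  · intro h m hm
    refine (hcoeff (Finsupp.equivFunOnFinite.symm m)).1 (h.coeff_eq_zero ?_)
    rwa [Finsupp.degree_eq_sum]
  · intro h d hd
    by_contra hne
    refine hd ((hcoeff d).2 (h d ?_))
    rwa [← Finsupp.degree_eq_sum, Finsupp.degree_eq_weight_one]

theorem polyModel_conj_of_tBasis {A : Module.End K (TPow K n)}
    {F : Module.End K (MvPolynomial (Fin n) K)}
    (h : ∀ m, polyModel t ψ (A (tBasis K n m)) = F (polyModel t ψ (tBasis K n m)))
    (x : TPow K n) : polyModel t ψ (A x) = F (polyModel t ψ x) :=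
  LinearMap.congr_fun
    (f := (polyModel t ψ).toLinearMap ∘ₗ A) (g := F ∘ₗ (polyModel t ψ).toLinearMap)
    ((tBasis K n).ext h) x

theorem pderiv_prod_erase_siteMonomial (k : Fin n) (m : Fin n → ℕ) :
    pderiv k (∏ j ∈ Finset.univ.erase k, siteMonomial t ψ j (m j)) = 0 := by
  refine Finset.prod_induction _ (fun p => pderiv k p = 0) (fun p q hp hq => ?_) pderiv_one
    fun j hj => ?_
  · rw [pderiv_mul, hp, hq, zero_mul, mul_zero, add_zero]
  · rw [siteMonomial, pderiv_C_mul, pderiv_pow, pderiv_X_of_ne (Finset.ne_of_mem_erase hj),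
      mul_zero, mul_zero]

theorem polyModel_atSite_of_raising {A : Module.End K (ℕ →₀ K)} {a : ℕ → K} {d : K}
    (hA : ∀ m, A (Finsupp.single m 1) = a m • Finsupp.single (m + 1) 1)
    (ha : ∀ m, a m * ψ (m + 1) = ψ m * d) (k : Fin n) (x : TPow K n) :
    polyModel t ψ (atSite k A x) =
      C (d * (t ^ (k : ℕ) : Kˣ)) * X k * polyModel t ψ x := by
  refine polyModel_conj_of_tBasis t ψ (F := LinearMap.mulLeft K (C (d * (t ^ (k : ℕ) : Kˣ)) * X k))
    (fun m => ?_) x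
  have hweight : a (m k) * siteWeight t ψ k (m k + 1) =
      d * (t ^ (k : ℕ) : Kˣ) * siteWeight t ψ k (m k) := by
    simp only [siteWeight, Units.val_mul, mul_add, mul_one, pow_add]
    linear_combination ((t ^ ((k : ℕ) * m k) : Kˣ) : K) * (t ^ (k : ℕ) : Kˣ) * ha (m k)
  rw [atSite_tBasis (hA _), map_smul, polyModel_tBasis_update, LinearMap.mulLeft_apply,
    polyModel_tBasis_eq_mul t ψ k m]
  have hC := congrArg (C (σ := Fin n)) hweight
  simp only [C_mul] at hC
  rw [siteMonomial, siteMonomial, smul_eq_C_mul, C_mul]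
  linear_combination (X k ^ (m k + 1) *
    ∏ j ∈ Finset.univ.erase k, siteMonomial t ψ j (m j)) * hC

theorem polyModel_atSite_of_lowering {A : Module.End K (ℕ →₀ K)} {a : ℕ → K} {d : K}
    (hA : ∀ m, A (Finsupp.single m 1) = a m • Finsupp.single (m - 1) 1)
    (ha : ∀ m, a m * ψ (m - 1) = ψ m * m * d) (k : Fin n) (x : TPow K n) :
    polyModel t ψ (atSite k A x) =
      (d * ((t ^ (k : ℕ))⁻¹ : Kˣ)) • pderiv k (polyModel t ψ x) := by
  refine polyModel_conj_of_tBasis t ψ (F := (d * ((t ^ (k : ℕ))⁻¹ : Kˣ)) • (pderiv k).toLinearMap)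
    (fun m => ?_) x
  have hweight : a (m k) * siteWeight t ψ k (m k - 1) =
      d * ((t ^ (k : ℕ))⁻¹ : Kˣ) * (siteWeight t ψ k (m k) * m k) := by
    rcases hm : m k with _ | b
    · simpa [hm] using ha 0
    · have hb := ha (b + 1)
      simp only [Nat.add_sub_cancel] at hb
      simp only [siteWeight, Nat.add_sub_cancel, Units.val_mul, mul_add, mul_one, pow_add]
      have ht := Units.inv_mul (t ^ (k : ℕ))
      linear_combination ((t ^ ((k : ℕ) * b) : Kˣ) : K) * hb -
        d * (t ^ ((k : ℕ) * b) : Kˣ) * ψ (b + 1) * (b + 1 : ℕ) * ht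
  rw [atSite_tBasis (hA _), map_smul, polyModel_tBasis_update, LinearMap.smul_apply,
    polyModel_tBasis_eq_mul t ψ k m]
  change _ = _ • pderiv k _
  have hC := congrArg (C (σ := Fin n)) hweight
  simp only [C_mul, map_natCast] at hC
  rw [pderiv_mul, pderiv_prod_erase_siteMonomial, siteMonomial, siteMonomial, pderiv_C_mul,
    pderiv_pow, pderiv_X_self, smul_eq_C_mul, smul_eq_C_mul, C_mul]
  linear_combination (X k ^ (m k - 1) *
    ∏ j ∈ Finset.univ.erase k, siteMonomial t ψ j (m j)) * hC

theorem polyModel_skewPrimitive_of_lowering {A : Module.End K (ℕ →₀ K)} {a : ℕ → K} {d : K}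
    (hA : ∀ m, A (Finsupp.single m 1) = a m • Finsupp.single (m - 1) 1)
    (ha : ∀ m, a m * ψ (m - 1) = ψ m * m * d) (r : K) (x : TPow K n) :
    polyModel t ψ (skewPrimitive n ((t * r) • LinearMap.id) A (r • LinearMap.id) x) =
      (d * r ^ (n - 1)) • translation (Fin n) K (polyModel t ψ x) := by
  rw [skewPrimitive_smul_id, LinearMap.sum_apply, map_sum, translation_eq_sum_pderiv,
    Finset.smul_sum]
  refine Finset.sum_congr rfl fun k _ => ?_
  have hpow : (t * r : K) ^ (k : ℕ) * r ^ (n - 1 - k) = r ^ (n - 1) * (t ^ (k : ℕ) : Kˣ) := by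
    rw [mul_pow, mul_assoc, ← pow_add, Nat.add_sub_cancel' (Nat.le_sub_one_of_lt k.2),
      Units.val_pow_eq_pow_val, mul_comm]
  have ht := Units.mul_inv (t ^ (k : ℕ))
  rw [LinearMap.smul_apply, map_smul, hpow, polyModel_atSite_of_lowering t ψ hA ha, smul_smul]
  congr 1
  linear_combination (d * r ^ (n - 1)) * ht

end PolyModel

section ShearSwap

variable {R : Type*} [CommRing R] {n : ℕ}

/-- The substitution `u_i ↦ u_i + κ u_{i+1}`, the exponential of the nilpotent derivation
`κ u_{i+1} ∂/∂u_i`. -/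
def shear (κ : R) (i : Fin (n - 1)) : MvPolynomial (Fin n) R →ₐ[R] MvPolynomial (Fin n) R :=
  aeval fun k => if k = lft i then X (lft i) + C κ * X (rgt i) else X k

/-- The exchange of two neighbouring variables, combined with the rescaling by `Q` of the one that
moves to the right. -/
def twistedSwap (Q : R) (i : Fin (n - 1)) :
    MvPolynomial (Fin n) R →ₐ[R] MvPolynomial (Fin n) R :=
  aeval fun k => if k = lft i then C Q * X (rgt i) else if k = rgt i then X (lft i) else X k

theorem twistedSwap_lft (Q : R) (i : Fin (n - 1)) :
    twistedSwap Q i (X (lft i)) = C Q * X (rgt i) := by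
  simp [twistedSwap]

theorem twistedSwap_rgt (Q : R) (i : Fin (n - 1)) :
    twistedSwap Q i (X (rgt i)) = X (lft i) := by
  simp [twistedSwap, (lft_ne_rgt i).symm]

theorem twistedSwap_of_ne (Q : R) (i : Fin (n - 1)) {k : Fin n} (hl : k ≠ lft i)
    (hr : k ≠ rgt i) : twistedSwap Q i (X k) = X k := by
  simp [twistedSwap, hl, hr]

theorem twistedSwap_comp_shear (Q : R) (i : Fin (n - 1)) :
    (twistedSwap Q i).comp (shear (1 - Q) i) = burau Q i := by
  refine algHom_ext fun k => ?_
  rw [AlgHom.comp_apply]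
  rcases eq_or_ne k (lft i) with rfl | hl
  · simp [burau, shear, twistedSwap, (lft_ne_rgt i).symm, add_comm]
  · simp [burau, shear, twistedSwap, hl]

end ShearSwap

section TruncatedExp

variable {K A : Type*} [Field K] [CommRing A] [Algebra K A] {D : Derivation K A A} {x y r : A}

theorem iterate_derivation_pow_mul (hx : D x = y) (hy : D y = 0) (hr : D r = 0) (a k : ℕ) :
    D^[k] (x ^ a * r) = (a.descFactorial k : A) * (y ^ k * x ^ (a - k) * r) := by
  induction k with
  | zero => simp
  | succ k ih =>
    rw [Function.iterate_succ_apply', ih, Nat.descFactorial_succ, Nat.sub_add_eq]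
    simp only [Derivation.leibniz, Derivation.leibniz_pow, Derivation.map_natCast, hx, hy, hr,
      smul_eq_mul, nsmul_eq_mul, Nat.cast_mul]
    ring

theorem sum_iterate_derivation_pow_mul [CharZero K] (hx : D x = y) (hy : D y = 0) (hr : D r = 0)
    (a : ℕ) :
    ∑ k ∈ Finset.range (a + 1), (k.factorial : K)⁻¹ • D^[k] (x ^ a * r) = (x + y) ^ a * r := by
  rw [add_comm x y, add_pow, Finset.sum_mul]
  refine Finset.sum_congr rfl fun k _ => ?_
  have hchoose : (k.factorial : K)⁻¹ * a.descFactorial k = a.choose k := by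
    rw [Nat.descFactorial_eq_factorial_mul_choose, Nat.cast_mul,
      inv_mul_cancel_left₀ (Nat.cast_ne_zero.2 k.factorial_ne_zero)]
  have hsmul (b : ℕ) : (b : A) = algebraMap K A b := (map_natCast _ b).symm
  rw [iterate_derivation_pow_mul hx hy hr, Algebra.smul_def, hsmul, hsmul, ← mul_assoc, ← map_mul,
    hchoose]
  ring

end TruncatedExp

section PolyModelBraiding

variable {K : Type} [Field K] {n : ℕ} (t : Kˣ) (ψ : ℕ → Kˣ)

theorem twistedSwap_siteMonomial (i : Fin (n - 1)) (k : Fin n) (a : ℕ) :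
    twistedSwap (t ^ 2 : K) i (siteMonomial t ψ k a) =
      C ((if k = lft i then (t : K) ^ a else 1) * if k = rgt i then (t : K) ^ a else 1) *
        siteMonomial t ψ (Equiv.swap (lft i) (rgt i) k) a := by
  rw [siteMonomial, map_mul, map_pow, algHom_C, algebraMap_eq]
  rcases eq_or_ne k (lft i) with rfl | hl
  · rw [twistedSwap_lft, Equiv.swap_apply_left, if_pos rfl, if_neg (lft_ne_rgt i), mul_one]
    simp only [siteMonomial, siteWeight, lft, rgt, Units.val_mul, Units.val_pow_eq_pow_val, C_mul,
      C_pow]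
    ring
  rcases eq_or_ne k (rgt i) with rfl | hr
  · rw [twistedSwap_rgt, Equiv.swap_apply_right, if_pos rfl, if_neg hl, one_mul]
    simp only [siteMonomial, siteWeight, lft, rgt, Units.val_mul, Units.val_pow_eq_pow_val, C_mul,
      C_pow]
    ring
  · rw [twistedSwap_of_ne _ i hl hr, Equiv.swap_apply_of_ne_of_ne hl hr, if_neg hl, if_neg hr,
      one_mul, C_1, one_mul, siteMonomial]

theorem polyModel_swap (i : Fin (n - 1)) (x : TPow K n) :
    polyModel t ψ (PiTensorProduct.reindex K (fun _ => ℕ →₀ K) (Equiv.swap (lft i) (rgt i))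
      ((tBasis K n).constr K (fun m => (t ^ (m (lft i) + m (rgt i)) : K) • tBasis K n m) x)) =
      twistedSwap (t ^ 2 : K) i (polyModel t ψ x) := by
  refine polyModel_conj_of_tBasis t ψ
    (A := (PiTensorProduct.reindex K (fun _ => ℕ →₀ K) (Equiv.swap (lft i) (rgt i))).toLinearMap ∘ₗ
      (tBasis K n).constr K fun m => (t ^ (m (lft i) + m (rgt i)) : K) • tBasis K n m)
    (F := (twistedSwap (t ^ 2 : K) i).toLinearMap) (fun m => ?_) x
  have hweight : (∏ k, (if k = lft i then (t : K) ^ m k else 1) *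
      if k = rgt i then (t : K) ^ m k else 1) = (t ^ (m (lft i) + m (rgt i)) : K) := by
    simp only [Finset.prod_mul_distrib, Finset.prod_ite_eq', Finset.mem_univ, if_true, pow_add]
  have hswap := Equiv.prod_comp (Equiv.swap (lft i) (rgt i)) fun k =>
    siteMonomial t ψ k (m (Equiv.swap (lft i) (rgt i) k))
  simp only [Equiv.swap_apply_self] at hswap
  rw [LinearMap.comp_apply, Module.Basis.constr_basis, LinearEquiv.coe_coe, map_smul,
    reindex_tBasis, map_smul, polyModel_tBasis, AlgHom.toLinearMap_apply, polyModel_tBasis,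
    map_prod, Finset.prod_congr rfl fun k _ => twistedSwap_siteMonomial t ψ i k (m k),
    Finset.prod_mul_distrib, ← map_prod, hweight, hswap, smul_eq_C_mul, Equiv.symm_swap]
  rfl

/-- The derivation `κ u_{i+1} ∂/∂u_i`, which is nilpotent on each polynomial. -/
def shearDeriv (κ : K) (i : Fin (n - 1)) :
    Derivation K (MvPolynomial (Fin n) K) (MvPolynomial (Fin n) K) :=
  (C κ * X (rgt i)) • pderiv (lft i)

theorem shear_prod_erase_siteMonomial (κ : K) (i : Fin (n - 1)) (m : Fin n → ℕ) :
    shear κ i (∏ j ∈ Finset.univ.erase (lft i), siteMonomial t ψ j (m j)) =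
      ∏ j ∈ Finset.univ.erase (lft i), siteMonomial t ψ j (m j) := by
  rw [map_prod]
  refine Finset.prod_congr rfl fun j hj => ?_
  simp [shear, siteMonomial, Finset.ne_of_mem_erase hj]

theorem sum_iterate_shearDeriv [CharZero K] (κ : K) (i : Fin (n - 1)) (m : Fin n → ℕ) :
    ∑ k ∈ Finset.range (m (lft i) + 1),
      (k.factorial : K)⁻¹ • (shearDeriv κ i)^[k] (polyModel t ψ (tBasis K n m)) =
      shear κ i (polyModel t ψ (tBasis K n m)) := by
  have hx : shearDeriv κ i (X (lft i)) = C κ * X (rgt i) := by simp [shearDeriv]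
  have hy : shearDeriv κ i (C κ * X (rgt i)) = 0 := by
    simp [shearDeriv, pderiv_X_of_ne (lft_ne_rgt i).symm]
  set w := ((siteWeight t ψ (lft i) (m (lft i)) : Kˣ) : K)
  set r := ∏ j ∈ Finset.univ.erase (lft i), siteMonomial t ψ j (m j) with hr
  have hwr : shearDeriv κ i (C w * r) = 0 := by
    simp [shearDeriv, hr, pderiv_prod_erase_siteMonomial]
  have hmodel : polyModel t ψ (tBasis K n m) = X (lft i) ^ m (lft i) * (C w * r) := by
    rw [polyModel_tBasis_eq_mul t ψ (lft i) m, siteMonomial]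
    ring
  have hshear : shear κ i r = r := shear_prod_erase_siteMonomial t ψ κ i m
  rw [hmodel, sum_iterate_derivation_pow_mul hx hy hwr, map_mul, map_pow, map_mul, hshear]
  simp [shear]

theorem polyModel_exp [CharZero K] {κ : K} {i : Fin (n - 1)} {N : Module.End K (TPow K n)}
    (hN : ∀ x, polyModel t ψ (N x) = shearDeriv κ i (polyModel t ψ x)) (x : TPow K n) :
    polyModel t ψ ((tBasis K n).constr K (fun m => ∑ k ∈ Finset.range (m (lft i) + 1),
      (k.factorial : K)⁻¹ • (N ^ k) (tBasis K n m)) x) = shear κ i (polyModel t ψ x) := by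
  refine polyModel_conj_of_tBasis t ψ (F := (shear κ i).toLinearMap) (fun m => ?_) x
  have hsemi : Function.Semiconj (polyModel t ψ) N (shearDeriv κ i) := hN
  have hiterate (k : ℕ) : polyModel t ψ ((N ^ k) (tBasis K n m)) =
      (shearDeriv κ i)^[k] (polyModel t ψ (tBasis K n m)) := by
    rw [Module.End.coe_pow, (hsemi.iterate_right k).eq]
  rw [Module.Basis.constr_basis, map_sum, AlgHom.toLinearMap_apply, ← sum_iterate_shearDeriv]
  exact Finset.sum_congr rfl fun k _ => by rw [map_smul, hiterate]

theorem polyModel_tBasis_update_update {l r : Fin n} (hlr : l ≠ r) (m : Fin n → ℕ) (a b : ℕ) :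
    polyModel t ψ (tBasis K n (Function.update (Function.update m l a) r b)) =
      siteMonomial t ψ l a * siteMonomial t ψ r b *
        ∏ j ∈ (Finset.univ.erase r).erase l, siteMonomial t ψ j (m j) := by
  rw [polyModel_tBasis_update, ← Finset.mul_prod_erase (Finset.univ.erase r)
    (fun j => siteMonomial t ψ j (Function.update m l a j))
    (Finset.mem_erase.2 ⟨hlr, Finset.mem_univ _⟩), Function.update_self,
    Finset.prod_congr rfl fun j hj => by
      rw [Function.update_of_ne (Finset.ne_of_mem_erase hj)]]
  ring

end PolyModelBraiding

section ModelRep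

variable {K M : Type*} [Field K] [AddCommMonoid M] [Module K M] {n : ℕ} {S : Submodule K M}
  {e : M ≃ₗ[K] MvPolynomial (Fin n) K} (hS : ∀ x, x ∈ S ↔ e x ∈ transInvQuad (Fin n) K)

/-- A submodule that a linear isomorphism to the polynomial ring maps onto the translation-invariant
quadratic forms, identified with the space of these forms. -/
def modelEquiv : S ≃ₗ[K] transInvQuad (Fin n) K :=
  (LinearEquiv.ofEq _ _ (Submodule.ext hS)).trans (e.ofSubmodule' (transInvQuad (Fin n) K))

theorem coe_modelEquiv (x : S) : (modelEquiv hS x : MvPolynomial (Fin n) K) = e x := rfl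

theorem apply_modelEquiv_symm (p : transInvQuad (Fin n) K) :
    e ((modelEquiv hS).symm p : M) = p := by
  rw [← coe_modelEquiv hS, LinearEquiv.apply_symm_apply]

/-- The braid group representation on such a submodule. -/
def modelRep (Q : Kˣ) : Representation K (BraidGroup n) S :=
  transportRep (quadRep n Q) (modelEquiv hS).symm

theorem coe_modelRep_braidGen {Q : Kˣ} {i : Fin (n - 1)} {A : Module.End K M}
    (hA : ∀ x, e (A x) = burau (Q : K) i (e x)) (x : S) :
    (modelRep hS Q (braidGen i) x : M) = A x := by
  apply e.injective
  rw [modelRep, transportRep_apply, apply_modelEquiv_symm, coe_quadRep_braidGen, hA,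
    LinearEquiv.symm_symm, coe_modelEquiv]

variable {N : Type*} [AddCommMonoid N] [Module K N] {S' : Submodule K N}
  {e' : N ≃ₗ[K] MvPolynomial (Fin n) K} (hS' : ∀ x, x ∈ S' ↔ e' x ∈ transInvQuad (Fin n) K)

/-- The isomorphism of two such representations through the space of quadratic forms, multiplied by
the unit `u`. -/
def modelRepEquiv (Q u : Kˣ) : (modelRep hS Q).Equiv (modelRep hS' Q) :=
  (unitSMulEquiv (modelRep hS Q) u).trans
    ((transportRepEquiv _ _).symm.trans (transportRepEquiv _ _))

theorem apply_modelRepEquiv (Q u : Kˣ) (x : S) :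
    e' (modelRepEquiv hS hS' Q u x : N) = (u : K) • e x := by
  change e' ((modelEquiv hS').symm (modelEquiv hS ((u : K) • x)) : N) = _
  rw [apply_modelEquiv_symm, coe_modelEquiv, Submodule.coe_smul, map_smul]

end ModelRep

section RootForms

variable {R : Type*} [CommRing R] {n : ℕ} {i l : Fin (n - 1)}

theorem burau_stepDiff_self (Q : R) : burau Q i (stepDiff R i) = -(C Q * stepDiff R i) := by
  rw [stepDiff, map_sub, burau_lft, burau_rgt, C_sub, C_1]
  ring

theorem burau_stepDiff_of_far (Q : R) (h : (l : ℕ) + 1 < i ∨ (i : ℕ) + 1 < l) :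
    burau Q i (stepDiff R l) = stepDiff R l := by
  rw [stepDiff, map_sub, burau_of_ne, burau_of_ne]
  all_goals
    simp only [lft, rgt, ne_eq, Fin.mk.injEq]
    omega

theorem burau_stepDiff_of_eq_add_one (Q : R) (h : (l : ℕ) = i + 1) :
    burau Q i (stepDiff R l) = stepDiff R i + stepDiff R l := by
  have hl : lft l = rgt i := Fin.ext h
  rw [stepDiff, stepDiff, map_sub, hl, burau_rgt, burau_of_ne, sub_add_sub_cancel]
  all_goals
    simp only [lft, rgt, ne_eq, Fin.mk.injEq]
    omega

theorem burau_stepDiff_of_add_one_eq (Q : R) (h : (l : ℕ) + 1 = i) :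
    burau Q i (stepDiff R l) = C Q * stepDiff R i + stepDiff R l := by
  have hr : rgt l = lft i := Fin.ext h
  rw [stepDiff, stepDiff, map_sub, hr, burau_lft, burau_of_ne, C_sub, C_1]
  · ring
  all_goals
    simp only [lft, rgt, ne_eq, Fin.mk.injEq]
    omega

/-- The linear form `t^i (u_i - u_{i+1})`, by which the operator `𝒪_i` multiplies up to a scalar
that does not depend on `i`. -/
def rootForm (t : R) (i : Fin (n - 1)) : MvPolynomial (Fin n) R := C (t ^ (i : ℕ)) * stepDiff R i

variable {t : R}

theorem burau_rootForm_self : burau (t ^ 2) i (rootForm t i) = -(C t ^ 2 * rootForm t i) := by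
  rw [rootForm, map_mul, burau_C, burau_stepDiff_self, C_pow t 2]
  ring

theorem burau_rootForm_of_far (h : (l : ℕ) + 1 < i ∨ (i : ℕ) + 1 < l) :
    burau (t ^ 2) i (rootForm t l) = rootForm t l := by
  rw [rootForm, map_mul, burau_C, burau_stepDiff_of_far _ h]

theorem burau_rootForm_of_adjacent (h : (l : ℕ) = i + 1 ∨ (l : ℕ) + 1 = i) :
    burau (t ^ 2) i (rootForm t l) = C t * rootForm t i + rootForm t l := by
  rcases h with h | h
  · rw [rootForm, rootForm, map_mul, burau_C, burau_stepDiff_of_eq_add_one _ h, h, pow_succ, C_mul]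
    ring
  · rw [rootForm, rootForm, map_mul, burau_C, burau_stepDiff_of_add_one_eq _ h, ← h,
      pow_succ t l, C_mul, C_pow t 2]
    ring

end RootForms

/-! ### The lowest weight space of the quantum oscillator algebra -/

section Oscillator

variable {q γ : ℝ} {n : ℕ}

theorem ofReal_rpow_mul_of_add_eq (hq0 : 0 < q) {a b c : ℝ} (h : a + b = c) :
    ((q ^ a : ℝ) : ℂ) * ((q ^ b : ℝ) : ℂ) = ((q ^ c : ℝ) : ℂ) := by
  rw [← Complex.ofReal_mul, ← Real.rpow_add hq0, h]

theorem ofReal_rpow_pow (hq0 : 0 < q) (a : ℝ) (k : ℕ) :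
    ((q ^ a : ℝ) : ℂ) ^ k = ((q ^ (a * k) : ℝ) : ℂ) := by
  rw [Real.rpow_mul_natCast hq0.le, Complex.ofReal_pow]

theorem ofReal_rpow_ne_zero (hq0 : 0 < q) (a : ℝ) : ((q ^ a : ℝ) : ℂ) ≠ 0 :=
  Complex.ofReal_ne_zero.2 (Real.rpow_pos_of_pos hq0 a).ne'

theorem sub_inv_eq_zero (hq0 : 0 < q) : q - q⁻¹ = 0 ↔ q = 1 := by
  rw [sub_eq_zero, ← mul_eq_one_iff_eq_inv₀ hq0.ne', ← sq,
    pow_eq_one_iff_of_nonneg hq0.le two_ne_zero]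

theorem qNumSqrt_sq : HOq.qNumSqrt q γ ^ 2 = HOq.qNum q γ := by
  rw [HOq.qNumSqrt, one_div]
  exact_mod_cast Complex.cpow_nat_inv_pow (HOq.qNum q γ : ℂ) two_ne_zero

theorem sub_inv_mul_qNum (hq0 : 0 < q) :
    ((q : ℂ) - (q : ℂ)⁻¹) * HOq.qNum q γ = ((q ^ γ : ℝ) : ℂ) - ((q ^ (-γ) : ℝ) : ℂ) := by
  have hreal : (q - q⁻¹) * HOq.qNum q γ = q ^ γ - q ^ (-γ) :=
    mul_div_cancel_of_imp' fun h => by rw [(sub_inv_eq_zero hq0).1 h]; simp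
  exact_mod_cast congrArg Complex.ofReal hreal

theorem qNum_ne_zero (hq0 : 0 < q) (hq1 : q ≠ 1) (hγ : γ ≠ 0) : HOq.qNum q γ ≠ 0 := by
  refine div_ne_zero (sub_ne_zero.2 fun h => hγ ?_) (mt (sub_inv_eq_zero hq0).1 hq1)
  linarith [(Real.rpow_right_inj hq0 hq1).1 h]

theorem qNumSqrt_ne_zero (hq0 : 0 < q) (hq1 : q ≠ 1) (hγ : γ ≠ 0) : HOq.qNumSqrt q γ ≠ 0 := by
  rw [← pow_ne_zero_iff two_ne_zero, qNumSqrt_sq]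
  exact_mod_cast qNum_ne_zero hq0 hq1 hγ

theorem sqrt_factorial_pos (a : ℕ) : 0 < Real.sqrt a.factorial :=
  Real.sqrt_pos.2 (Nat.cast_pos.2 a.factorial_pos)

/-- The factors `(a!)^{-1/2}` that normalize the basis vectors `h_a`. -/
def invSqrtFactorial (a : ℕ) : ℂˣ :=
  Units.mk0 ((Real.sqrt a.factorial : ℂ)⁻¹)
    (inv_ne_zero (Complex.ofReal_ne_zero.2 (sqrt_factorial_pos a).ne'))

theorem sqrt_mul_invSqrtFactorial_succ (a : ℕ) :
    (Real.sqrt (a + 1) : ℂ) * invSqrtFactorial (a + 1) = invSqrtFactorial a := by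
  have hfactorial : Real.sqrt (a + 1).factorial = Real.sqrt (a + 1) * Real.sqrt a.factorial := by
    rw [← Real.sqrt_mul (by positivity), Nat.factorial_succ]
    push_cast
    rfl
  have hne : (Real.sqrt (a + 1) : ℂ) ≠ 0 :=
    Complex.ofReal_ne_zero.2 (Real.sqrt_pos.2 (by positivity)).ne'
  rw [invSqrtFactorial, invSqrtFactorial, Units.val_mk0, Units.val_mk0, hfactorial,
    Complex.ofReal_mul, mul_inv, mul_inv_cancel_left₀ hne]

theorem sqrt_mul_invSqrtFactorial_pred (a : ℕ) :
    (Real.sqrt a : ℂ) * invSqrtFactorial (a - 1) = invSqrtFactorial a * a := by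
  rcases a with _ | a
  · simp
  · have hsq : (Real.sqrt ((a : ℝ) + 1) : ℂ) ^ 2 = a + 1 := by
      rw [← Complex.ofReal_pow, Real.sq_sqrt (by positivity)]
      push_cast
      rfl
    rw [Nat.add_sub_cancel, ← sqrt_mul_invSqrtFactorial_succ a]
    push_cast
    linear_combination (invSqrtFactorial (a + 1) : ℂ) * hsq

/-- The nonzero complex number `q^x`. -/
def qUnit (hq0 : 0 < q) (x : ℝ) : ℂˣ := Units.mk0 ((q ^ x : ℝ) : ℂ) (ofReal_rpow_ne_zero hq0 x)

theorem coe_qUnit (hq0 : 0 < q) (x : ℝ) : (qUnit hq0 x : ℂ) = ((q ^ x : ℝ) : ℂ) := rfl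

variable (γ n) in
/-- The polynomial model of the tensor power of the oscillator module. -/
def hoModel (hq0 : 0 < q) : TPow ℂ n ≃ₗ[ℂ] MvPolynomial (Fin n) ℂ :=
  polyModel (qUnit hq0 (-γ)) invSqrtFactorial

theorem alphaMinus_single (m : ℕ) : HOq.alphaMinus q γ (Finsupp.single m 1) =
    (HOq.qNumSqrt q γ * (Real.sqrt m : ℂ)) • Finsupp.single (m - 1) 1 := by
  simp [HOq.alphaMinus]

theorem alphaPlus_single (m : ℕ) : HOq.alphaPlus q γ (Finsupp.single m 1) =
    (HOq.qNumSqrt q γ * (Real.sqrt (m + 1) : ℂ)) • Finsupp.single (m + 1) 1 := by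
  simp [HOq.alphaPlus]

theorem alphaMinus_weight (m : ℕ) :
    HOq.qNumSqrt q γ * (Real.sqrt m : ℂ) * invSqrtFactorial (m - 1) =
      invSqrtFactorial m * m * HOq.qNumSqrt q γ := by
  rw [mul_assoc, sqrt_mul_invSqrtFactorial_pred, mul_comm]

theorem hoModel_atSite_alphaMinus (hq0 : 0 < q) (k : Fin n) (x : TPow ℂ n) :
    hoModel γ n hq0 (atSite k (HOq.alphaMinus q γ) x) =
      (HOq.qNumSqrt q γ * ((qUnit hq0 (-γ) ^ (k : ℕ))⁻¹ : ℂˣ)) •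
        pderiv k (hoModel γ n hq0 x) :=
  polyModel_atSite_of_lowering _ _ alphaMinus_single alphaMinus_weight k x

theorem hoModel_atSite_alphaPlus (hq0 : 0 < q) (k : Fin n) (x : TPow ℂ n) :
    hoModel γ n hq0 (atSite k (HOq.alphaPlus q γ) x) =
      C (HOq.qNumSqrt q γ * (qUnit hq0 (-γ) ^ (k : ℕ) : ℂˣ)) * X k * hoModel γ n hq0 x :=
  polyModel_atSite_of_raising _ _ alphaPlus_single
    (fun m => by rw [mul_assoc, sqrt_mul_invSqrtFactorial_succ, mul_comm]) k x

theorem hoModel_coprodAlphaMinus (hq0 : 0 < q) (x : TPow ℂ n) :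
    hoModel γ n hq0 (HOq.coprodAlphaMinus q γ n x) =
      (HOq.qNumSqrt q γ * ((q ^ (1 / 2 * γ) : ℝ) : ℂ) ^ (n - 1)) •
        translation (Fin n) ℂ (hoModel γ n hq0 x) := by
  have hl : HOq.qGam q γ (-1 / 2) =
      ((qUnit hq0 (-γ) : ℂ) * ((q ^ (1 / 2 * γ) : ℝ) : ℂ)) • LinearMap.id := by
    rw [coe_qUnit, ofReal_rpow_mul_of_add_eq hq0 (c := -1 / 2 * γ) (by ring), HOq.qGam]
  rw [HOq.coprodAlphaMinus, hl]
  exact polyModel_skewPrimitive_of_lowering _ _ alphaMinus_single alphaMinus_weight _ x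

theorem nilPart_eq (hq0 : 0 < q) (i : Fin (n - 1)) :
    HOq.nilPart q γ i = ((q : ℂ) - (q : ℂ)⁻¹) •
      (atSite (lft i) (HOq.alphaMinus q γ) * atSite (rgt i) (HOq.alphaPlus q γ)) := by
  have hhalf := ofReal_rpow_mul_of_add_eq hq0 (a := 1 / 2 * γ) (b := -1 / 2 * γ) (c := 0) (by ring)
  rw [Real.rpow_zero, Complex.ofReal_one] at hhalf
  rw [HOq.nilPart, HOq.qGam, HOq.qGam, atPair_eq_mul, atPair_eq_mul, atSite_smul, atSite_smul,
    atSite_id, atSite_id, smul_mul_smul_comm, hhalf, one_smul, one_mul, one_mul]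

theorem hoModel_nilPart (hq0 : 0 < q) (i : Fin (n - 1)) (x : TPow ℂ n) :
    hoModel γ n hq0 (HOq.nilPart q γ i x) =
      shearDeriv (1 - (qUnit hq0 (-γ) : ℂ) ^ 2) i (hoModel γ n hq0 x) := by
  set t := qUnit hq0 (-γ) with ht
  have hst : ((q ^ γ : ℝ) : ℂ) * t = 1 := by
    rw [ht, coe_qUnit, ofReal_rpow_mul_of_add_eq hq0 (add_neg_cancel γ), Real.rpow_zero,
      Complex.ofReal_one]
  have hqNum := sub_inv_mul_qNum (γ := γ) hq0
  rw [← qNumSqrt_sq, ← coe_qUnit hq0 (-γ), ← ht] at hqNum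
  have hpow : ((t ^ (lft i : ℕ))⁻¹ : ℂˣ) * ((t ^ (rgt i : ℕ) : ℂˣ) : ℂ) = t := by
    rw [← Units.val_mul, show (rgt i : ℕ) = lft i + 1 from rfl, pow_succ, inv_mul_cancel_left]
  have hscalar : ((q : ℂ) - (q : ℂ)⁻¹) * (HOq.qNumSqrt q γ * ((t ^ (lft i : ℕ))⁻¹ : ℂˣ)) *
      (HOq.qNumSqrt q γ * (t ^ (rgt i : ℕ) : ℂˣ)) = 1 - (t : ℂ) ^ 2 := by
    linear_combination ((q : ℂ) - (q : ℂ)⁻¹) * HOq.qNumSqrt q γ ^ 2 * hpow + t * hqNum + hst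
  rw [nilPart_eq hq0, LinearMap.smul_apply, map_smul, Module.End.mul_apply,
    hoModel_atSite_alphaMinus, hoModel_atSite_alphaPlus, pderiv_mul, pderiv_C_mul,
    pderiv_X_of_ne (lft_ne_rgt i).symm, ← hscalar]
  simp only [shearDeriv, Derivation.smul_apply, smul_eq_C_mul, C_mul, smul_eq_mul]
  ring

theorem cartanPart_eq (hq0 : 0 < q) (c : ℝ) (i : Fin (n - 1)) :
    ((q ^ (2 * c * γ) : ℝ) : ℂ) • HOq.cartanPart q γ c i = (tBasis ℂ n).constr ℂ fun m =>
      ((qUnit hq0 (-γ) : ℂ) ^ (m (lft i) + m (rgt i))) • tBasis ℂ n m := by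
  refine (tBasis ℂ n).ext fun m => ?_
  rw [LinearMap.smul_apply, HOq.cartanPart, Module.Basis.constr_basis, Module.Basis.constr_basis,
    smul_smul, coe_qUnit, ofReal_rpow_pow hq0, ofReal_rpow_mul_of_add_eq hq0]
  push_cast
  ring

theorem hoModel_sigmaNorm (hq0 : 0 < q) (c : ℝ) (i : Fin (n - 1)) (x : TPow ℂ n) :
    hoModel γ n hq0 (HOq.sigmaNorm q γ c i x) =
      burau ((qUnit hq0 (-γ) : ℂ) ^ 2) i (hoModel γ n hq0 x) := by
  have hexp : hoModel γ n hq0 (HOq.expNilPart q γ i x) =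
      shear (1 - (qUnit hq0 (-γ) : ℂ) ^ 2) i (hoModel γ n hq0 x) :=
    polyModel_exp _ _ (hoModel_nilPart hq0 i) x
  have hswap := polyModel_swap (qUnit hq0 (-γ)) invSqrtFactorial i (HOq.expNilPart q γ i x)
  rw [← cartanPart_eq hq0 c i] at hswap
  rw [← twistedSwap_comp_shear, AlgHom.comp_apply, ← hexp]
  refine Eq.trans ?_ hswap
  simp only [HOq.sigmaNorm, HOq.sigma, LinearMap.smul_apply, LinearMap.comp_apply,
    LinearEquiv.coe_coe, map_smul]
  rfl

theorem coprodGam_apply (x : TPow ℂ n) : HOq.coprodGam γ n x = ((n : ℂ) * γ) • x := by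
  simp [HOq.coprodGam, HOq.gam, atSite_smul, atSite_id, mul_smul, Nat.cast_smul_eq_nsmul,
    smul_comm n]

theorem coprodEps_tBasis (c : ℝ) (m : Fin n → ℕ) :
    HOq.coprodEps c n (tBasis ℂ n m) = ((∑ k, m k : ℕ) + n * c : ℂ) • tBasis ℂ n m := by
  have hk (k : Fin n) : atSite k (HOq.eps c) (tBasis ℂ n m) = ((m k : ℂ) + c) • tBasis ℂ n m := by
    rw [atSite_tBasis (a := m k) (c := (m k : ℂ) + c) (by simp [HOq.eps]),
      Function.update_eq_self]
  rw [HOq.coprodEps, LinearMap.sum_apply, Finset.sum_congr rfl fun k _ => hk k, ← Finset.sum_smul,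
    Finset.sum_add_distrib]
  simp

theorem repr_coprodEps (c : ℝ) (x : TPow ℂ n) (m : Fin n → ℕ) :
    (tBasis ℂ n).repr (HOq.coprodEps c n x) m =
      ((∑ k, m k : ℕ) + n * c) * (tBasis ℂ n).repr x m := by
  suffices h : (tBasis ℂ n).coord m ∘ₗ HOq.coprodEps c n =
      ((∑ k, m k : ℕ) + n * c : ℂ) • (tBasis ℂ n).coord m from LinearMap.congr_fun h x
  refine (tBasis ℂ n).ext fun d => ?_
  rw [LinearMap.comp_apply, coprodEps_tBasis, map_smul, LinearMap.smul_apply,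
    Module.Basis.coord_apply, Module.Basis.repr_self, Finsupp.single_apply]
  split_ifs with h
  · rw [h]
  · simp

theorem mem_weightSpace_iff {c : ℝ} {l : ℕ} {x : TPow ℂ n} :
    x ∈ HOq.weightSpace γ c n (n * γ) (n * c + l) ↔ x ∈ JK.V ℂ n l := by
  have hΓ : x ∈ LinearMap.ker
      (HOq.coprodGam γ n - ((n * γ : ℝ) : ℂ) • (LinearMap.id : Module.End ℂ (TPow ℂ n))) := by
    simp [coprodGam_apply]
  rw [HOq.weightSpace, Submodule.mem_inf, and_iff_right hΓ, LinearMap.mem_ker,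
    LinearMap.sub_apply, LinearMap.smul_apply, LinearMap.id_apply, sub_eq_zero,
    ← (tBasis ℂ n).repr.injective.eq_iff, Finsupp.ext_iff, mem_V_iff]
  refine forall_congr' fun m => ?_
  have hsub : ((∑ k, m k : ℕ) + n * c : ℂ) - ((n * c + l : ℝ) : ℂ) = (∑ k, m k : ℕ) - (l : ℕ) := by
    push_cast
    ring
  rw [repr_coprodEps, map_smul, Finsupp.smul_apply, smul_eq_mul, ← sub_eq_zero, ← sub_mul, hsub,
    mul_eq_zero, sub_eq_zero, Nat.cast_inj, or_iff_not_imp_left]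

theorem mem_lowestWeightSpace_iff (hq0 : 0 < q) (hq1 : q ≠ 1) (hγ : γ ≠ 0) (c : ℝ)
    (x : TPow ℂ n) :
    x ∈ HOq.lowestWeightSpace q γ c n (n * c + 2) ↔
      hoModel γ n hq0 x ∈ transInvQuad (Fin n) ℂ := by
  have hne : HOq.qNumSqrt q γ * ((q ^ (1 / 2 * γ) : ℝ) : ℂ) ^ (n - 1) ≠ 0 :=
    mul_ne_zero (qNumSqrt_ne_zero hq0 hq1 hγ) (pow_ne_zero _ (ofReal_rpow_ne_zero hq0 _))
  rw [HOq.lowestWeightSpace, Submodule.mem_inf, mem_transInvQuad, hoModel, isHomogeneous_polyModel]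
  refine and_congr ?_ ?_
  · exact_mod_cast mem_weightSpace_iff (l := 2)
  · rw [LinearMap.mem_ker, ← (hoModel γ n hq0).map_eq_zero_iff, hoModel_coprodAlphaMinus,
      smul_eq_zero, or_iff_right hne]
    rfl

theorem opO_eq (hq0 : 0 < q) (hq1 : q ≠ 1) (hγ : γ ≠ 0) (i : Fin (n - 1)) :
    HOq.opO q γ i = ((q ^ (-1 / 2 * γ) : ℝ) : ℂ) • atSite (lft i) (HOq.alphaPlus q γ) -
      ((q ^ (1 / 2 * γ) : ℝ) : ℂ) • atSite (rgt i) (HOq.alphaPlus q γ) := by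
  have hg := qNumSqrt_ne_zero hq0 hq1 hγ
  have hsmul (a b : ℂ) (A : Module.End ℂ (ℕ →₀ ℂ)) :
      a • LinearMap.id * b • LinearMap.id * A = (a * b) • A := by
    ext
    simp [mul_left_comm, mul_assoc]
  rw [HOq.opO, HOq.qGam, HOq.qGam, HOq.invSqrtGam, HOq.sqrtGam, hsmul, hsmul, atPair_eq_mul,
    atPair_eq_mul]
  simp only [atSite_smul, atSite_id, smul_mul_smul_comm, mul_one, one_mul]
  rw [mul_assoc, inv_mul_cancel₀ hg, mul_one, mul_left_comm, mul_inv_cancel₀ hg, mul_one]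

theorem hoModel_opO (hq0 : 0 < q) (hq1 : q ≠ 1) (hγ : γ ≠ 0) (i : Fin (n - 1)) (x : TPow ℂ n) :
    hoModel γ n hq0 (HOq.opO q γ i x) =
      C (HOq.qNumSqrt q γ * ((q ^ (-1 / 2 * γ) : ℝ) : ℂ)) *
        rootForm (qUnit hq0 (-γ) : ℂ) i * hoModel γ n hq0 x := by
  have hhalf : ((q ^ (1 / 2 * γ) : ℝ) : ℂ) * (qUnit hq0 (-γ) : ℂ) = ((q ^ (-1 / 2 * γ) : ℝ) : ℂ) :=
    ofReal_rpow_mul_of_add_eq hq0 (by ring)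
  have hC := congrArg (C (σ := Fin n)) hhalf
  rw [C_mul] at hC
  rw [opO_eq hq0 hq1 hγ, LinearMap.sub_apply, LinearMap.smul_apply, LinearMap.smul_apply, map_sub,
    map_smul, map_smul, hoModel_atSite_alphaPlus, hoModel_atSite_alphaPlus, rootForm, stepDiff]
  have hl : (lft i : ℕ) = i := rfl
  have hr : (rgt i : ℕ) = i + 1 := rfl
  simp only [smul_eq_C_mul, C_mul, hl, hr, pow_succ, Units.val_mul,
    Units.val_pow_eq_pow_val, C_pow]
  linear_combination (-C (HOq.qNumSqrt q γ) * C (qUnit hq0 (-γ) : ℂ) ^ (i : ℕ) * X (rgt i) *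
    hoModel γ n hq0 x) * hC

theorem hoModel_v0 (hq0 : 0 < q) : hoModel γ n hq0 (HOq.v0 n) = 1 := by
  rw [HOq.v0, hoModel, polyModel_tBasis]
  simp [siteMonomial, siteWeight, invSqrtFactorial]

theorem hoModel_w (hq0 : 0 < q) (hq1 : q ≠ 1) (hγ : γ ≠ 0) (i j : Fin (n - 1)) :
    hoModel γ n hq0 (HOq.w q γ i j) = ((HOq.qNum q γ : ℂ) * (qUnit hq0 (-γ) : ℂ)) •
      (rootForm (qUnit hq0 (-γ) : ℂ) i * rootForm (qUnit hq0 (-γ) : ℂ) j) := by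
  have hhalf : ((q ^ (-1 / 2 * γ) : ℝ) : ℂ) ^ 2 = qUnit hq0 (-γ) := by
    rw [sq]
    exact ofReal_rpow_mul_of_add_eq hq0 (by ring)
  rw [HOq.w, hoModel_opO hq0 hq1 hγ, hoModel_opO hq0 hq1 hγ, hoModel_v0, smul_eq_C_mul,
    ← qNumSqrt_sq, ← hhalf, ← mul_pow, C_pow]
  ring

theorem w_comm (hq0 : 0 < q) (hq1 : q ≠ 1) (hγ : γ ≠ 0) (i j : Fin (n - 1)) :
    HOq.w q γ i j = HOq.w q γ j i :=
  (hoModel γ n hq0).injective <| by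
    rw [hoModel_w hq0 hq1 hγ, hoModel_w hq0 hq1 hγ, mul_comm (rootForm _ i)]

/-- The vectors `w_{i,j}`, `i ≤ j`, as a basis of the lowest weight space. -/
def wBasis (hq0 : 0 < q) (hq1 : q ≠ 1) (hγ : γ ≠ 0) (c : ℝ) :
    Module.Basis {p : Fin (n - 1) × Fin (n - 1) // p.1 ≤ p.2} ℂ
      (HOq.lowestWeightSpace q γ c n (n * c + 2)) :=
  ((stepBasis ℂ n).isUnitSMul
    (w := fun p => HOq.qNum q γ * (qUnit hq0 (-γ) : ℂ) *
      ((qUnit hq0 (-γ) ^ (p.1.1 : ℕ) * qUnit hq0 (-γ) ^ (p.1.2 : ℕ) : ℂˣ) : ℂ))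
    fun _ => (((Complex.ofReal_ne_zero.2 (qNum_ne_zero hq0 hq1 hγ)).isUnit.mul
      (Units.isUnit _)).mul (Units.isUnit _))).map
    (modelEquiv (mem_lowestWeightSpace_iff hq0 hq1 hγ c)).symm

theorem coe_wBasis (hq0 : 0 < q) (hq1 : q ≠ 1) (hγ : γ ≠ 0) (c : ℝ)
    (p : {p : Fin (n - 1) × Fin (n - 1) // p.1 ≤ p.2}) :
    (wBasis hq0 hq1 hγ c p : TPow ℂ n) = HOq.w q γ p.1.1 p.1.2 := by
  apply (hoModel γ n hq0).injective
  rw [hoModel_w hq0 hq1 hγ, wBasis, Module.Basis.map_apply, apply_modelEquiv_symm,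
    Module.Basis.isUnitSMul_apply, Submodule.coe_smul, coe_stepBasis, rootForm, rootForm]
  simp only [smul_eq_C_mul, C_mul, Units.val_mul, Units.val_pow_eq_pow_val]
  ring

theorem finrank_lowestWeightSpace (hq0 : 0 < q) (hq1 : q ≠ 1) (hγ : γ ≠ 0) (c : ℝ) :
    Module.finrank ℂ (HOq.lowestWeightSpace q γ c n (n * c + 2)) = n * (n - 1) / 2 := by
  rw [(modelEquiv (mem_lowestWeightSpace_iff hq0 hq1 hγ c)).finrank_eq, finrank_transInvQuad,
    card_lt_pairs]

theorem ofReal_rpow_neg_two_mul (hq0 : 0 < q) :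
    ((q ^ (-2 * γ) : ℝ) : ℂ) = (qUnit hq0 (-γ) : ℂ) ^ 2 := by
  rw [coe_qUnit, ofReal_rpow_pow hq0]
  ring_nf

theorem ofReal_rpow_neg_four_mul (hq0 : 0 < q) :
    ((q ^ (-4 * γ) : ℝ) : ℂ) = (qUnit hq0 (-γ) : ℂ) ^ 4 := by
  rw [coe_qUnit, ofReal_rpow_pow hq0]
  ring_nf

section SigmaFormulas

variable {i j k l r : Fin (n - 1)}

theorem hoModel_sigmaNorm_w (hq0 : 0 < q) (hq1 : q ≠ 1) (hγ : γ ≠ 0) (c : ℝ)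
    (i j k : Fin (n - 1)) :
    hoModel γ n hq0 (HOq.sigmaNorm q γ c i (HOq.w q γ j k)) =
      ((HOq.qNum q γ : ℂ) * (qUnit hq0 (-γ) : ℂ)) •
        (burau ((qUnit hq0 (-γ) : ℂ) ^ 2) i (rootForm (qUnit hq0 (-γ) : ℂ) j) *
          burau ((qUnit hq0 (-γ) : ℂ) ^ 2) i (rootForm (qUnit hq0 (-γ) : ℂ) k)) := by
  rw [hoModel_sigmaNorm, hoModel_w hq0 hq1 hγ, map_smul, map_mul]

theorem sigmaNorm_w_of_far_of_far (hq0 : 0 < q) (hq1 : q ≠ 1) (hγ : γ ≠ 0) (c : ℝ)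
    (hj : (j : ℕ) + 1 < i ∨ (i : ℕ) + 1 < j) (hk : (k : ℕ) + 1 < i ∨ (i : ℕ) + 1 < k) :
    HOq.sigmaNorm q γ c i (HOq.w q γ j k) = HOq.w q γ j k := by
  apply (hoModel γ n hq0).injective
  rw [hoModel_sigmaNorm_w hq0 hq1 hγ, burau_rootForm_of_far hj, burau_rootForm_of_far hk,
    hoModel_w hq0 hq1 hγ]

theorem sigmaNorm_w_self_self (hq0 : 0 < q) (hq1 : q ≠ 1) (hγ : γ ≠ 0) (c : ℝ)
    (i : Fin (n - 1)) :
    HOq.sigmaNorm q γ c i (HOq.w q γ i i) = ((q ^ (-4 * γ) : ℝ) : ℂ) • HOq.w q γ i i := by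
  apply (hoModel γ n hq0).injective
  rw [hoModel_sigmaNorm_w hq0 hq1 hγ, burau_rootForm_self, map_smul, hoModel_w hq0 hq1 hγ,
    ofReal_rpow_neg_four_mul hq0]
  simp only [smul_eq_C_mul, C_pow]
  ring

theorem sigmaNorm_w_self_of_far (hq0 : 0 < q) (hq1 : q ≠ 1) (hγ : γ ≠ 0) (c : ℝ)
    (hk : (k : ℕ) + 1 < i ∨ (i : ℕ) + 1 < k) :
    HOq.sigmaNorm q γ c i (HOq.w q γ i k) = (-((q ^ (-2 * γ) : ℝ) : ℂ)) • HOq.w q γ i k := by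
  apply (hoModel γ n hq0).injective
  rw [hoModel_sigmaNorm_w hq0 hq1 hγ, burau_rootForm_self, burau_rootForm_of_far hk, map_smul,
    hoModel_w hq0 hq1 hγ, ofReal_rpow_neg_two_mul hq0]
  simp only [smul_eq_C_mul, C_neg, C_pow]
  ring

theorem sigmaNorm_w_of_adjacent_of_far (hq0 : 0 < q) (hq1 : q ≠ 1) (hγ : γ ≠ 0) (c : ℝ)
    (hl : (l : ℕ) = i + 1 ∨ (l : ℕ) + 1 = i) (hk : (k : ℕ) + 1 < i ∨ (i : ℕ) + 1 < k) :
    HOq.sigmaNorm q γ c i (HOq.w q γ l k) =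
      ((q ^ (-γ) : ℝ) : ℂ) • HOq.w q γ i k + HOq.w q γ l k := by
  apply (hoModel γ n hq0).injective
  rw [hoModel_sigmaNorm_w hq0 hq1 hγ, burau_rootForm_of_adjacent hl, burau_rootForm_of_far hk,
    map_add, map_smul, hoModel_w hq0 hq1 hγ, hoModel_w hq0 hq1 hγ, ← coe_qUnit hq0]
  simp only [smul_eq_C_mul]
  ring

theorem sigmaNorm_w_of_adjacent_self (hq0 : 0 < q) (hq1 : q ≠ 1) (hγ : γ ≠ 0) (c : ℝ)
    (hl : (l : ℕ) = i + 1 ∨ (l : ℕ) + 1 = i) :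
    HOq.sigmaNorm q γ c i (HOq.w q γ l i) =
      (-((q ^ (-2 * γ) : ℝ) : ℂ)) • (HOq.w q γ l i + ((q ^ (-γ) : ℝ) : ℂ) • HOq.w q γ i i) := by
  apply (hoModel γ n hq0).injective
  rw [hoModel_sigmaNorm_w hq0 hq1 hγ, burau_rootForm_of_adjacent hl, burau_rootForm_self, map_smul,
    map_add, map_smul, hoModel_w hq0 hq1 hγ, hoModel_w hq0 hq1 hγ, ofReal_rpow_neg_two_mul hq0,
    ← coe_qUnit hq0]
  simp only [smul_eq_C_mul, C_neg, C_pow]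
  ring

theorem sigmaNorm_w_of_adjacent_of_adjacent (hq0 : 0 < q) (hq1 : q ≠ 1) (hγ : γ ≠ 0) (c : ℝ)
    (hl : (l : ℕ) = i + 1 ∨ (l : ℕ) + 1 = i) (hr : (r : ℕ) = i + 1 ∨ (r : ℕ) + 1 = i) :
    HOq.sigmaNorm q γ c i (HOq.w q γ l r) =
      ((q ^ (-2 * γ) : ℝ) : ℂ) • HOq.w q γ i i +
        ((q ^ (-γ) : ℝ) : ℂ) • (HOq.w q γ l i + HOq.w q γ i r) + HOq.w q γ l r := by
  apply (hoModel γ n hq0).injective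
  rw [hoModel_sigmaNorm_w hq0 hq1 hγ, burau_rootForm_of_adjacent hl, burau_rootForm_of_adjacent hr,
    ofReal_rpow_neg_two_mul hq0, ← coe_qUnit hq0]
  simp only [map_add, map_smul, hoModel_w hq0 hq1 hγ, smul_eq_C_mul, C_pow]
  ring

theorem sigmaNorm_w_of_adjacent_sq (hq0 : 0 < q) (hq1 : q ≠ 1) (hγ : γ ≠ 0) (c : ℝ)
    (hl : (l : ℕ) = i + 1 ∨ (l : ℕ) + 1 = i) :
    HOq.sigmaNorm q γ c i (HOq.w q γ l l) =
      ((q ^ (-2 * γ) : ℝ) : ℂ) • HOq.w q γ i i +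
        (2 * ((q ^ (-γ) : ℝ) : ℂ)) • HOq.w q γ l i + HOq.w q γ l l := by
  rw [sigmaNorm_w_of_adjacent_of_adjacent hq0 hq1 hγ c hl hl, w_comm hq0 hq1 hγ i l, ← two_smul ℂ,
    smul_smul, mul_comm 2 ((q ^ (-γ) : ℝ) : ℂ)]

end SigmaFormulas

end Oscillator

/-! ### The Jackson–Kerler representation -/

section JacksonKerler

variable {K : Type} [Field K] {n : ℕ}

theorem qBinom_one (a b : ℕ) : JK.qBinom (1 : K) a b = a.choose b := by
  induction a generalizing b with
  | zero => cases b <;> simp [JK.qBinom]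
  | succ a ih => cases b <;> simp [JK.qBinom, ih, Nat.choose_succ_succ, add_comm]

theorem rCoeff_one (s : Kˣ) (a b k : ℕ) :
    JK.rCoeff 1 (s : K) a b k =
      (s⁻¹ : Kˣ) ^ (a + b) * ((b + k).choose b : K) * ((s : K) - (s⁻¹ : Kˣ)) ^ k := by
  have hpow : (s : K) ^ (-((a : ℤ) + b)) = (s⁻¹ : Kˣ) ^ (a + b) := by
    rw [zpow_neg, Units.val_inv_eq_inv_val, inv_pow]
    exact_mod_cast rfl
  rw [JK.rCoeff, hpow, qBinom_one, add_comm k b]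
  simp

theorem opK_one (s : K) : JK.opK 1 s = s • LinearMap.id := by
  refine Finsupp.basisSingleOne.ext fun m => ?_
  simp [JK.opK]

theorem zpow_sub_natCast (s : Kˣ) (j k : ℕ) :
    (s : K) ^ ((j : ℤ) - (k : ℤ)) = (s : K) ^ j * ((s⁻¹ : Kˣ) : K) ^ k := by
  rw [zpow_sub₀ s.ne_zero, zpow_natCast, zpow_natCast, Units.val_inv_eq_inv_val, inv_pow,
    div_eq_mul_inv]

/-- The polynomial that models the vector `W_{j,k}`. -/
def vecForm (t : K) (j k : Fin n) : MvPolynomial (Fin n) K :=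
  C (-2⁻¹ * (t ^ (j : ℕ) * t ^ (k : ℕ))) * (X j - X k) ^ 2

theorem vecForm_comm (t : K) (j k : Fin n) : vecForm t j k = vecForm t k j := by
  rw [vecForm, vecForm, mul_comm (t ^ _), ← neg_sub (X k), neg_sq]

theorem vecForm_self (t : K) (j : Fin n) : vecForm t j j = 0 := by
  simp [vecForm]

variable [CharZero K]

/-- The factors `1 / a!` that normalize the basis vectors `v_a`. -/
def invFactorial (K : Type) [Field K] [CharZero K] (a : ℕ) : Kˣ :=
  Units.mk0 (a.factorial : K)⁻¹ (inv_ne_zero (Nat.cast_ne_zero.2 a.factorial_ne_zero))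

theorem invFactorial_eq_succ_mul (a : ℕ) :
    (invFactorial K a : K) = invFactorial K (a + 1) * (a + 1 : ℕ) := by
  rw [invFactorial, invFactorial, Units.val_mk0, Units.val_mk0, Nat.factorial_succ, Nat.cast_mul,
    mul_inv, mul_right_comm, inv_mul_cancel₀ (Nat.cast_ne_zero.2 a.succ_ne_zero), one_mul]

theorem choose_mul_invFactorial (a b : ℕ) :
    ((a + b).choose a : K) * invFactorial K (a + b) = invFactorial K a * invFactorial K b := by
  have hne : ((a + b).factorial : K) ≠ 0 := Nat.cast_ne_zero.2 (Nat.factorial_ne_zero _)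
  simp only [invFactorial, Units.val_mk0]
  rw [Nat.cast_add_choose, div_mul_eq_mul_div, mul_inv_cancel₀ hne, one_div, mul_inv]

variable (n) in
/-- The polynomial model of the tensor power of the generic Verma module. -/
def vermaModel (s : Kˣ) : TPow K n ≃ₗ[K] MvPolynomial (Fin n) K := polyModel s⁻¹ (invFactorial K)

theorem rCoeff_mul_siteWeight (s : Kˣ) (i : Fin (n - 1)) (k e b : ℕ) :
    JK.rCoeff 1 (s : K) (k + e) b k * (siteWeight s⁻¹ (invFactorial K) (lft i) (b + k) *
        siteWeight s⁻¹ (invFactorial K) (rgt i) e : Kˣ) =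
      (siteWeight s⁻¹ (invFactorial K) (lft i) (k + e) *
        siteWeight s⁻¹ (invFactorial K) (rgt i) b : Kˣ) *
        ((1 - ((s⁻¹ : Kˣ) : K) ^ 2) ^ k * (((s⁻¹ : Kˣ) : K) ^ 2) ^ e * ((k + e).choose k : K)) := by
  have hr : (rgt i : ℕ) = (lft i : ℕ) + 1 := rfl
  have hst : 1 - ((s⁻¹ : Kˣ) : K) ^ 2 = ((s : K) - (s⁻¹ : Kˣ)) * (s⁻¹ : Kˣ) := by
    rw [sub_mul, Units.mul_inv, sq]
  have hb := choose_mul_invFactorial (K := K) b k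
  have he := choose_mul_invFactorial (K := K) k e
  rw [rCoeff_one, hst, mul_pow _ _ k]
  simp only [siteWeight, hr, Units.val_mul, Units.val_pow_eq_pow_val]
  set t := ((s⁻¹ : Kˣ) : K)
  linear_combination t ^ (k + e + b + (lft i : ℕ) * (b + k) + ((lft i : ℕ) + 1) * e) *
    ((s : K) - t) ^ k * (invFactorial K e * hb - invFactorial K b * he)

theorem vermaModel_sigma (s : Kˣ) (i : Fin (n - 1)) (x : TPow K n) :
    vermaModel n s (JK.sigma 1 (s : K) i x) =
      burau (((s⁻¹ : Kˣ) : K) ^ 2) i (vermaModel n s x) := by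
  refine polyModel_conj_of_tBasis s⁻¹ (invFactorial K)
    (F := (burau (((s⁻¹ : Kˣ) : K) ^ 2) i).toLinearMap) (fun m => ?_) x
  have hlr := lft_ne_rgt i
  set r := ∏ j ∈ (Finset.univ.erase (rgt i)).erase (lft i),
    siteMonomial s⁻¹ (invFactorial K) j (m j) with hr
  have hupdate (a b : ℕ) :
      polyModel s⁻¹ (invFactorial K)
          (tBasis K n (Function.update (Function.update m (lft i) a) (rgt i) b)) =
        siteMonomial s⁻¹ (invFactorial K) (lft i) a *
          siteMonomial s⁻¹ (invFactorial K) (rgt i) b * r :=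
    polyModel_tBasis_update_update s⁻¹ (invFactorial K) hlr m a b
  have hfix : burau (((s⁻¹ : Kˣ) : K) ^ 2) i r = r := by
    rw [hr, map_prod]
    refine Finset.prod_congr rfl fun j hj => ?_
    rw [Finset.mem_erase, Finset.mem_erase] at hj
    rw [siteMonomial, map_mul, map_pow, burau_C, burau_of_ne _ _ hj.1 hj.2.1]
  have hm := hupdate (m (lft i)) (m (rgt i))
  rw [Function.update_eq_self, Function.update_eq_self] at hm
  rw [JK.sigma, Module.Basis.constr_basis, map_sum, AlgHom.toLinearMap_apply, hm]
  simp only [map_smul, hupdate]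
  simp only [siteMonomial, map_mul, map_pow, burau_C, burau_lft, burau_rgt, hfix]
  rw [add_pow, Finset.mul_sum, Finset.sum_mul, Finset.sum_mul]
  refine Finset.sum_congr rfl fun k hk => ?_
  obtain ⟨e, he⟩ := Nat.exists_eq_add_of_le (Finset.mem_range_succ_iff.1 hk)
  have hC := congrArg (C (σ := Fin n)) (rCoeff_mul_siteWeight s i k e (m (rgt i)))
  simp only [C_mul, C_pow, map_natCast, Units.val_mul] at hC
  rw [he, Nat.add_sub_cancel_left, smul_eq_C_mul, mul_pow, mul_pow, ← C_pow, ← C_pow]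
  simp only [C_pow]
  linear_combination (X (lft i) ^ (m (rgt i) + k) * X (rgt i) ^ e * r) * hC

theorem vermaModel_coprodE (s : Kˣ) (x : TPow K n) :
    vermaModel n s (JK.coprodE 1 (s : K) n x) =
      (s : K) ^ (n - 1) • translation (Fin n) K (vermaModel n s x) := by
  have hid : (LinearMap.id : Module.End K (ℕ →₀ K)) =
      (((s⁻¹ : Kˣ) : K) * s) • LinearMap.id := by
    rw [Units.inv_mul, one_smul]
  have hE (m : ℕ) : JK.opE (Finsupp.single m (1 : K)) =
      (if m = 0 then 0 else 1 : K) • Finsupp.single (m - 1) 1 := by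
    rcases m with _ | m <;> simp [JK.opE]
  rw [JK.coprodE, hid, opK_one, vermaModel, ← one_mul ((s : K) ^ (n - 1))]
  refine polyModel_skewPrimitive_of_lowering _ _ hE (fun m => ?_) _ x
  rcases m with _ | m
  · simp
  · simpa using invFactorial_eq_succ_mul m

theorem mem_W_iff (s : Kˣ) (x : TPow K n) :
    x ∈ JK.W 1 (s : K) n 2 ↔ vermaModel n s x ∈ transInvQuad (Fin n) K := by
  rw [JK.W, Submodule.mem_inf, mem_transInvQuad, LinearMap.mem_ker,
    ← (vermaModel n s).map_eq_zero_iff (x := JK.coprodE 1 (s : K) n x), vermaModel_coprodE,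
    smul_eq_zero, or_iff_right (pow_ne_zero _ s.ne_zero), vermaModel, isHomogeneous_polyModel]

theorem vermaModel_single_two (s : Kˣ) (j : Fin n) :
    vermaModel n s (tBasis K n (Pi.single j 2)) =
      C (2⁻¹ * (((s⁻¹ : Kˣ) : K) ^ (j : ℕ)) ^ 2) * X j ^ 2 := by
  rw [Pi.single, vermaModel, polyModel_tBasis_update]
  simp [siteMonomial, siteWeight, invFactorial, pow_mul, mul_comm]

theorem vermaModel_single_one_add_single_one (s : Kˣ) {j k : Fin n} (hjk : j ≠ k) :
    vermaModel n s (tBasis K n (Pi.single j 1 + Pi.single k 1)) =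
      C (((s⁻¹ : Kˣ) : K) ^ (j : ℕ) * ((s⁻¹ : Kˣ) : K) ^ (k : ℕ)) * (X j * X k) := by
  have hupdate : (Pi.single j 1 + Pi.single k 1 : Fin n → ℕ) =
      Function.update (Function.update (0 : Fin n → ℕ) j 1) k 1 := by
    funext a
    rcases eq_or_ne a k with rfl | hk
    · simp [hjk.symm]
    · rcases eq_or_ne a j with rfl | hj <;> simp [*]
  rw [hupdate, vermaModel, polyModel_tBasis_update_update _ _ hjk]
  simp only [siteMonomial, siteWeight, invFactorial, Nat.factorial_one, Nat.factorial_zero,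
    Nat.cast_one, inv_one, Units.mk0_one, Units.val_one, mul_one, mul_zero, inv_pow,
    Units.val_inv_eq_inv_val, Units.val_pow_eq_pow_val, pow_one, pow_zero, Pi.zero_apply, C_1,
    Finset.prod_const_one, C_mul]
  ring

theorem vermaModel_vec (s : Kˣ) {j k : Fin n} (hjk : j ≠ k) :
    vermaModel n s (JK.vec 1 (s : K) j k) = vecForm ((s⁻¹ : Kˣ) : K) j k := by
  have hinv (a : ℕ) : (C (s : K) : MvPolynomial (Fin n) K) ^ a * C ((s⁻¹ : Kˣ) : K) ^ a = 1 := by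
    rw [← mul_pow, ← C_mul, Units.mul_inv, C_1, one_pow]
  have htwo : (2 * C 2⁻¹ : MvPolynomial (Fin n) K) = 1 := by
    rw [← map_ofNat C 2, ← C_mul, mul_inv_cancel₀ two_ne_zero, C_1]
  rw [JK.vec, map_sub, map_sub, map_smul, map_smul, vermaModel_single_two, vermaModel_single_two,
    vermaModel_single_one_add_single_one s hjk, zpow_sub_natCast, zpow_sub_natCast, one_zpow,
    one_mul, vecForm]
  simp only [smul_eq_C_mul, C_mul, C_neg, C_pow]
  set t : MvPolynomial (Fin n) K := C ((s⁻¹ : Kˣ) : K)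
  linear_combination -(t ^ (j : ℕ) * t ^ (k : ℕ) * X j * X k) * htwo -
    t ^ (k : ℕ) * C 2⁻¹ * t ^ (j : ℕ) * X j ^ 2 * hinv j -
    t ^ (j : ℕ) * C 2⁻¹ * t ^ (k : ℕ) * X k ^ 2 * hinv k

-- polarization: `2 (a - b) (c - d) = (a - d)² + (b - c)² - (a - c)² - (b - d)²`
theorem rootForm_mul_rootForm (s : Kˣ) (i r : Fin (n - 1)) :
    C ((s⁻¹ : Kˣ) : K) * (rootForm ((s⁻¹ : Kˣ) : K) i * rootForm ((s⁻¹ : Kˣ) : K) r) =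
      -vecForm ((s⁻¹ : Kˣ) : K) (lft i) (rgt r) + (s : K) • vecForm ((s⁻¹ : Kˣ) : K) (rgt i) (rgt r)
        + (s : K)⁻¹ • vecForm ((s⁻¹ : Kˣ) : K) (lft i) (lft r)
        - vecForm ((s⁻¹ : Kˣ) : K) (rgt i) (lft r) := by
  have htwo : (2 * C 2⁻¹ : MvPolynomial (Fin n) K) = 1 := by
    rw [← map_ofNat C 2, ← C_mul, mul_inv_cancel₀ two_ne_zero, C_1]
  have hst : (C (s : K) * C ((s⁻¹ : Kˣ) : K) : MvPolynomial (Fin n) K) = 1 := by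
    rw [← C_mul, Units.mul_inv, C_1]
  have hl (a : Fin (n - 1)) : (lft a : ℕ) = a := rfl
  have hr (a : Fin (n - 1)) : (rgt a : ℕ) = a + 1 := rfl
  rw [← Units.val_inv_eq_inv_val]
  simp only [rootForm, stepDiff, vecForm, smul_eq_C_mul, C_mul, C_neg, C_pow, hl, hr, pow_succ]
  set t : MvPolynomial (Fin n) K := C ((s⁻¹ : Kˣ) : K)
  linear_combination (-(t ^ (i : ℕ) * t ^ (r : ℕ) * t * (X (lft i) - X (rgt i)) *
    (X (lft r) - X (rgt r)))) * htwo + (C 2⁻¹ * t ^ (i : ℕ) * t ^ (r : ℕ) * t *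
    (X (rgt i) - X (rgt r)) ^ 2) * hst

variable (n) in
/-- The vectors `W_{j,k}`, `j < k`, as a basis of `W_{n,2}`. -/
def vecBasis (s : Kˣ) :
    Module.Basis {p : Fin n × Fin n // p.1 < p.2} K (JK.W 1 (s : K) n 2) :=
  ((sqDiffBasis (Fin n) K).unitsSMul fun p => Units.mk0 (-2⁻¹) (by simp) *
    (s⁻¹ ^ (p.1.1 : ℕ) * s⁻¹ ^ (p.1.2 : ℕ))).map (modelEquiv (mem_W_iff s)).symm

theorem coe_vecBasis (s : Kˣ) (p : {p : Fin n × Fin n // p.1 < p.2}) :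
    (vecBasis n s p : TPow K n) = JK.vec 1 (s : K) p.1.1 p.1.2 := by
  apply (vermaModel n s).injective
  rw [vermaModel_vec s p.2.ne, vecBasis, Module.Basis.map_apply, apply_modelEquiv_symm,
    Module.Basis.unitsSMul_apply, Units.smul_def, Submodule.coe_smul, coe_sqDiffBasis, vecForm,
    smul_eq_C_mul, Units.val_mul, Units.val_mk0, Units.val_mul, Units.val_pow_eq_pow_val,
    Units.val_pow_eq_pow_val]

variable (n) in
/-- The Jackson–Kerler representation on `W_{n,2}` at `𝗊 = 1`. -/
def jkRep (s : Kˣ) : Representation K (BraidGroup n) (JK.W 1 (s : K) n 2) :=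
  modelRep (mem_W_iff s) (s⁻¹ ^ 2)

theorem coe_jkRep_braidGen (s : Kˣ) (i : Fin (n - 1)) (x : JK.W 1 (s : K) n 2) :
    (jkRep n s (braidGen i) x : TPow K n) = JK.sigma 1 (s : K) i x :=
  coe_modelRep_braidGen _ (fun y => by rw [vermaModel_sigma, Units.val_pow_eq_pow_val]) x

end JacksonKerler

/-! ### The braid group action on the lowest weight space -/

section HarmonicOscillatorRep

variable {n : ℕ} {q γ : ℝ}

theorem qUnit_neg (hq0 : 0 < q) : qUnit hq0 (-γ) = (qUnit hq0 γ)⁻¹ :=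
  Units.ext <| by simp [coe_qUnit, Real.rpow_neg hq0.le]

theorem coe_inv_qUnit_sq (hq0 : 0 < q) :
    (((qUnit hq0 γ)⁻¹ ^ 2 : ℂˣ) : ℂ) = ((q ^ (-2 * γ) : ℝ) : ℂ) := by
  rw [ofReal_rpow_neg_two_mul hq0, qUnit_neg, Units.val_pow_eq_pow_val]

variable (n) in
/-- The braid group representation on the lowest weight space of level two. -/
def hoRep (hq0 : 0 < q) (hq1 : q ≠ 1) (hγ : γ ≠ 0) (c : ℝ) :
    Representation ℂ (BraidGroup n) (HOq.lowestWeightSpace q γ c n (n * c + 2)) :=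
  modelRep (mem_lowestWeightSpace_iff hq0 hq1 hγ c) ((qUnit hq0 γ)⁻¹ ^ 2)

theorem coe_hoRep_braidGen (hq0 : 0 < q) (hq1 : q ≠ 1) (hγ : γ ≠ 0) (c : ℝ) (i : Fin (n - 1))
    (x : HOq.lowestWeightSpace q γ c n (n * c + 2)) :
    (hoRep n hq0 hq1 hγ c (braidGen i) x : TPow ℂ n) = HOq.sigmaNorm q γ c i x :=
  coe_modelRep_braidGen _ (fun y => by
    rw [hoModel_sigmaNorm, qUnit_neg, Units.val_pow_eq_pow_val]) x

variable (n) in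
/-- The isomorphism with the Jackson–Kerler representation, normalized by the factor `[γ]_q⁻¹`. -/
def hoRepEquivJK (hq0 : 0 < q) (hq1 : q ≠ 1) (hγ : γ ≠ 0) (c : ℝ) :
    (hoRep n hq0 hq1 hγ c).Equiv (jkRep n (qUnit hq0 γ)) :=
  modelRepEquiv _ _ _
    (Units.mk0 (HOq.qNum q γ : ℂ) (Complex.ofReal_ne_zero.2 (qNum_ne_zero hq0 hq1 hγ)))⁻¹

theorem vermaModel_hoRepEquivJK_wBasis (hq0 : 0 < q) (hq1 : q ≠ 1) (hγ : γ ≠ 0) (c : ℝ)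
    (p : {p : Fin (n - 1) × Fin (n - 1) // p.1 ≤ p.2}) :
    vermaModel n (qUnit hq0 γ) (hoRepEquivJK n hq0 hq1 hγ c (wBasis hq0 hq1 hγ c p)) =
      C (((qUnit hq0 γ)⁻¹ : ℂˣ) : ℂ) * (rootForm (((qUnit hq0 γ)⁻¹ : ℂˣ) : ℂ) p.1.1 *
        rootForm (((qUnit hq0 γ)⁻¹ : ℂˣ) : ℂ) p.1.2) := by
  refine (apply_modelRepEquiv _ _ _ _ _).trans ?_
  rw [coe_wBasis, hoModel_w hq0 hq1 hγ, qUnit_neg, smul_smul,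
    ← smul_eq_C_mul, Units.val_inv_eq_inv_val, Units.val_mk0,
    inv_mul_cancel_left₀ (Complex.ofReal_ne_zero.2 (qNum_ne_zero hq0 hq1 hγ))]

theorem hoRepEquivJK_wBasis_self (hq0 : 0 < q) (hq1 : q ≠ 1) (hγ : γ ≠ 0) (c : ℝ)
    (i : Fin (n - 1)) :
    (hoRepEquivJK n hq0 hq1 hγ c (wBasis hq0 hq1 hγ c ⟨(i, i), le_rfl⟩) : TPow ℂ n) =
      (-2 : ℂ) • JK.vec 1 (qUnit hq0 γ : ℂ) (lft i) (rgt i) := by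
  apply (vermaModel n (qUnit hq0 γ)).injective
  rw [vermaModel_hoRepEquivJK_wBasis, rootForm_mul_rootForm, map_smul,
    vermaModel_vec _ (lft_ne_rgt i), vecForm_self, vecForm_self, vecForm_comm _ (rgt i)]
  module

theorem hoRepEquivJK_wBasis_of_add_one_eq (hq0 : 0 < q) (hq1 : q ≠ 1) (hγ : γ ≠ 0) (c : ℝ)
    {i r : Fin (n - 1)} (h : i ≤ r) (hir : (i : ℕ) + 1 = r) :
    (hoRepEquivJK n hq0 hq1 hγ c (wBasis hq0 hq1 hγ c ⟨(i, r), h⟩) : TPow ℂ n) =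
      (qUnit hq0 γ : ℂ)⁻¹ • JK.vec 1 (qUnit hq0 γ : ℂ) (lft i) (rgt i)
        - JK.vec 1 (qUnit hq0 γ : ℂ) (lft i) (rgt r)
        + (qUnit hq0 γ : ℂ) • JK.vec 1 (qUnit hq0 γ : ℂ) (rgt i) (rgt r) := by
  have hmid : lft r = rgt i := Fin.ext hir.symm
  have hlt : rgt i < rgt r := hmid ▸ lft_lt_rgt r
  apply (vermaModel n (qUnit hq0 γ)).injective
  rw [vermaModel_hoRepEquivJK_wBasis, rootForm_mul_rootForm, map_add, map_sub, map_smul, map_smul,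
    vermaModel_vec _ (lft_ne_rgt i), vermaModel_vec _ hlt.ne,
    vermaModel_vec _ ((lft_lt_rgt i).trans hlt).ne, hmid, vecForm_self]
  module

theorem hoRepEquivJK_wBasis_of_add_two_le (hq0 : 0 < q) (hq1 : q ≠ 1) (hγ : γ ≠ 0) (c : ℝ)
    {i r : Fin (n - 1)} (h : i ≤ r) (hir : (i : ℕ) + 2 ≤ r) :
    (hoRepEquivJK n hq0 hq1 hγ c (wBasis hq0 hq1 hγ c ⟨(i, r), h⟩) : TPow ℂ n) =
      - JK.vec 1 (qUnit hq0 γ : ℂ) (lft i) (rgt r)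
        + (qUnit hq0 γ : ℂ) • JK.vec 1 (qUnit hq0 γ : ℂ) (rgt i) (rgt r)
        + (qUnit hq0 γ : ℂ)⁻¹ • JK.vec 1 (qUnit hq0 γ : ℂ) (lft i) (lft r)
        - JK.vec 1 (qUnit hq0 γ : ℂ) (rgt i) (lft r) := by
  have hmid : rgt i < lft r := hir
  have hli := lft_lt_rgt i
  have hlr := lft_lt_rgt r
  apply (vermaModel n (qUnit hq0 γ)).injective
  rw [vermaModel_hoRepEquivJK_wBasis, rootForm_mul_rootForm, map_sub, map_add, map_add, map_neg,
    map_smul, map_smul, vermaModel_vec _ (hli.trans (hmid.trans hlr)).ne,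
    vermaModel_vec _ (hmid.trans hlr).ne, vermaModel_vec _ (hli.trans hmid).ne,
    vermaModel_vec _ hmid.ne]

variable (n) in
/-- The isomorphism with the Lawrence–Krammer–Bigelow representation. -/
def hoRepEquivLKB (hq0 : 0 < q) (hq1 : q ≠ 1) (hγ : γ ≠ 0) (c : ℝ) :
    (hoRep n hq0 hq1 hγ c).Equiv (lkbRep n ((qUnit hq0 γ)⁻¹ ^ 2)) :=
  (transportRepEquiv _ _).symm.trans (transportRepEquiv _ _)

end HarmonicOscillatorRep

end

theorem mainTheorem6_general (n : ℕ) (q γ c : ℝ) (hq0 : 0 < q) (hq1 : q ≠ 1) (hγ : γ ≠ 0) :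
    ∃ ρ : Representation ℂ (BraidGroup n) (HOq.lowestWeightSpace q γ c n (n * c + 2)),
      (∀ (i : Fin (n - 1)) (x : HOq.lowestWeightSpace q γ c n (n * c + 2)),
        (ρ (braidGen i) x : TPow ℂ n) = HOq.sigmaNorm q γ c i x) ∧
      (∀ i j : Fin (n - 1), HOq.w q γ i j = HOq.w q γ j i) ∧
      (∃ b : Module.Basis {p : Fin (n - 1) × Fin (n - 1) // p.1 ≤ p.2} ℂ
            (HOq.lowestWeightSpace q γ c n (n * c + 2)),
        (∀ p, (b p : TPow ℂ n) = HOq.w q γ p.1.1 p.1.2) ∧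
        Module.finrank ℂ (HOq.lowestWeightSpace q γ c n (n * c + 2)) = n * (n - 1) / 2 ∧
        ∃ ρJK : Representation ℂ (BraidGroup n) (JK.W (1 : ℂ) ((q ^ γ : ℝ) : ℂ) n 2),
          (∀ (i : Fin (n - 1)) (x : JK.W (1 : ℂ) ((q ^ γ : ℝ) : ℂ) n 2),
            (ρJK (braidGen i) x : TPow ℂ n) = JK.sigma (1 : ℂ) ((q ^ γ : ℝ) : ℂ) i x) ∧
          (∃ bW : Module.Basis {p : Fin n × Fin n // p.1 < p.2} ℂ
                (JK.W (1 : ℂ) ((q ^ γ : ℝ) : ℂ) n 2),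
            ∀ p, (bW p : TPow ℂ n) = JK.vec (1 : ℂ) ((q ^ γ : ℝ) : ℂ) p.1.1 p.1.2) ∧
          ∃ Φ : ρ.Equiv ρJK,
            (∀ (i : Fin (n - 1)),
              (Φ (b ⟨(i, i), le_rfl⟩) : TPow ℂ n) =
                (-2 : ℂ) • JK.vec (1 : ℂ) ((q ^ γ : ℝ) : ℂ) (lft i) (rgt i)) ∧
            (∀ (i r : Fin (n - 1)) (h : i ≤ r), (i : ℕ) + 1 = r →
              (Φ (b ⟨(i, r), h⟩) : TPow ℂ n) =
                (((q ^ γ : ℝ) : ℂ)⁻¹) • JK.vec (1 : ℂ) ((q ^ γ : ℝ) : ℂ) (lft i) (rgt i)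
                  - JK.vec (1 : ℂ) ((q ^ γ : ℝ) : ℂ) (lft i) (rgt r)
                  + ((q ^ γ : ℝ) : ℂ) • JK.vec (1 : ℂ) ((q ^ γ : ℝ) : ℂ) (rgt i) (rgt r)) ∧
            (∀ (i r : Fin (n - 1)) (h : i ≤ r), (i : ℕ) + 2 ≤ r →
              (Φ (b ⟨(i, r), h⟩) : TPow ℂ n) =
                - JK.vec (1 : ℂ) ((q ^ γ : ℝ) : ℂ) (lft i) (rgt r)
                  + ((q ^ γ : ℝ) : ℂ) • JK.vec (1 : ℂ) ((q ^ γ : ℝ) : ℂ) (rgt i) (rgt r)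
                  + (((q ^ γ : ℝ) : ℂ)⁻¹) • JK.vec (1 : ℂ) ((q ^ γ : ℝ) : ℂ) (lft i) (lft r)
                  - JK.vec (1 : ℂ) ((q ^ γ : ℝ) : ℂ) (rgt i) (lft r))) ∧
      (∀ i j k : Fin (n - 1),
        (j : ℕ) + 1 < i ∨ (i : ℕ) + 1 < j → (k : ℕ) + 1 < i ∨ (i : ℕ) + 1 < k →
          HOq.sigmaNorm q γ c i (HOq.w q γ j k) = HOq.w q γ j k) ∧
      (∀ i : Fin (n - 1),
        HOq.sigmaNorm q γ c i (HOq.w q γ i i) =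
          ((q ^ (-4 * γ) : ℝ) : ℂ) • HOq.w q γ i i) ∧
      (∀ i k : Fin (n - 1), (k : ℕ) + 1 < i ∨ (i : ℕ) + 1 < k →
        HOq.sigmaNorm q γ c i (HOq.w q γ i k) =
          (-((q ^ (-2 * γ) : ℝ) : ℂ)) • HOq.w q γ i k ∧
        HOq.sigmaNorm q γ c i (HOq.w q γ k i) =
          (-((q ^ (-2 * γ) : ℝ) : ℂ)) • HOq.w q γ k i) ∧
      (∀ i l k : Fin (n - 1), (l : ℕ) = i + 1 ∨ (l : ℕ) + 1 = i →
        (k : ℕ) + 1 < i ∨ (i : ℕ) + 1 < k →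
        HOq.sigmaNorm q γ c i (HOq.w q γ l k) =
          ((q ^ (-γ) : ℝ) : ℂ) • HOq.w q γ i k + HOq.w q γ l k ∧
        HOq.sigmaNorm q γ c i (HOq.w q γ k l) =
          ((q ^ (-γ) : ℝ) : ℂ) • HOq.w q γ k i + HOq.w q γ k l) ∧
      (∀ i l : Fin (n - 1), (l : ℕ) + 1 = i →
        HOq.sigmaNorm q γ c i (HOq.w q γ l i) =
          (-((q ^ (-2 * γ) : ℝ) : ℂ)) •
            (HOq.w q γ l i + ((q ^ (-γ) : ℝ) : ℂ) • HOq.w q γ i i) ∧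
        HOq.sigmaNorm q γ c i (HOq.w q γ l l) =
          ((q ^ (-2 * γ) : ℝ) : ℂ) • HOq.w q γ i i +
            (2 * ((q ^ (-γ) : ℝ) : ℂ)) • HOq.w q γ l i + HOq.w q γ l l) ∧
      (∀ i r : Fin (n - 1), (r : ℕ) = i + 1 →
        HOq.sigmaNorm q γ c i (HOq.w q γ i r) =
          (-((q ^ (-2 * γ) : ℝ) : ℂ)) •
            (HOq.w q γ i r + ((q ^ (-γ) : ℝ) : ℂ) • HOq.w q γ i i) ∧
        HOq.sigmaNorm q γ c i (HOq.w q γ r r) =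
          ((q ^ (-2 * γ) : ℝ) : ℂ) • HOq.w q γ i i +
            (2 * ((q ^ (-γ) : ℝ) : ℂ)) • HOq.w q γ i r + HOq.w q γ r r) ∧
      (∀ i l r : Fin (n - 1), (l : ℕ) + 1 = i → (r : ℕ) = i + 1 →
        HOq.sigmaNorm q γ c i (HOq.w q γ l r) =
          ((q ^ (-2 * γ) : ℝ) : ℂ) • HOq.w q γ i i +
            ((q ^ (-γ) : ℝ) : ℂ) • (HOq.w q γ l i + HOq.w q γ i r) + HOq.w q γ l r) ∧
      ∃ ρL : Representation ℂ (BraidGroup n) (LKB.Idx n →₀ ℂ),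
        (∀ (i : Fin (n - 1)) (j k : Fin n), j < k →
          ρL (braidGen i) (LKB.v ℂ j k) =
            LKB.gen ((q ^ (-2 * γ) : ℝ) : ℂ) (-1) i j k) ∧
        Nonempty (ρ.Equiv ρL) :=
  ⟨hoRep n hq0 hq1 hγ c, coe_hoRep_braidGen hq0 hq1 hγ c, w_comm hq0 hq1 hγ,
    ⟨wBasis hq0 hq1 hγ c, coe_wBasis hq0 hq1 hγ c, finrank_lowestWeightSpace hq0 hq1 hγ c,
      jkRep n (qUnit hq0 γ), coe_jkRep_braidGen (qUnit hq0 γ),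
      ⟨vecBasis n (qUnit hq0 γ), coe_vecBasis (qUnit hq0 γ)⟩,
      hoRepEquivJK n hq0 hq1 hγ c, hoRepEquivJK_wBasis_self hq0 hq1 hγ c,
      fun _ _ => hoRepEquivJK_wBasis_of_add_one_eq hq0 hq1 hγ c,
      fun _ _ => hoRepEquivJK_wBasis_of_add_two_le hq0 hq1 hγ c⟩,
    fun _ _ _ => sigmaNorm_w_of_far_of_far hq0 hq1 hγ c,
    sigmaNorm_w_self_self hq0 hq1 hγ c,
    fun i k hk => ⟨sigmaNorm_w_self_of_far hq0 hq1 hγ c hk, by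
      rw [w_comm hq0 hq1 hγ k i, sigmaNorm_w_self_of_far hq0 hq1 hγ c hk]⟩,
    fun i l k hl hk => ⟨sigmaNorm_w_of_adjacent_of_far hq0 hq1 hγ c hl hk, by
      rw [w_comm hq0 hq1 hγ k l, w_comm hq0 hq1 hγ k i,
        sigmaNorm_w_of_adjacent_of_far hq0 hq1 hγ c hl hk]⟩,
    fun _ _ hl => ⟨sigmaNorm_w_of_adjacent_self hq0 hq1 hγ c (.inr hl),
      sigmaNorm_w_of_adjacent_sq hq0 hq1 hγ c (.inr hl)⟩,
    fun i r hr => by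
      simpa only [w_comm hq0 hq1 hγ r i] using
        And.intro (sigmaNorm_w_of_adjacent_self hq0 hq1 hγ c (.inl hr))
          (sigmaNorm_w_of_adjacent_sq hq0 hq1 hγ c (.inl hr)),
    fun _ _ _ hl hr => sigmaNorm_w_of_adjacent_of_adjacent hq0 hq1 hγ c (.inr hl) (.inl hr),
    lkbRep n ((qUnit hq0 γ)⁻¹ ^ 2),
    fun i _ _ hjk => coe_inv_qUnit_sq (γ := γ) hq0 ▸ lkbRep_braidGen _ i hjk,
    ⟨hoRepEquivLKB n hq0 hq1 hγ c⟩⟩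

theorem mainTheorem6 (n : ℕ) (q γ c : ℝ) (hq0 : 0 < q) (hq1 : q < 1) (hγ : γ ≠ 0) :
    -- the representation of `B_n` on the lowest weight space of level two
    ∃ ρ : Representation ℂ (BraidGroup n) (HOq.lowestWeightSpace q γ c n (n * c + 2)),
      (∀ (i : Fin (n - 1)) (x : HOq.lowestWeightSpace q γ c n (n * c + 2)),
        (ρ (braidGen i) x : TPow ℂ n) = HOq.sigmaNorm q γ c i x) ∧
      -- the `w_{i,j}` with `i ≤ j` are a basis, and the dimension is `n (n - 1) / 2`
      (∀ i j : Fin (n - 1), HOq.w q γ i j = HOq.w q γ j i) ∧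
      (∃ b : Module.Basis {p : Fin (n - 1) × Fin (n - 1) // p.1 ≤ p.2} ℂ
            (HOq.lowestWeightSpace q γ c n (n * c + 2)),
        (∀ p, (b p : TPow ℂ n) = HOq.w q γ p.1.1 p.1.2) ∧
        Module.finrank ℂ (HOq.lowestWeightSpace q γ c n (n * c + 2)) = n * (n - 1) / 2 ∧
        -- the change of basis to the Jackson–Kerler representation `W_{n,2}`
        -- (first parameter `1`, second parameter `s = q^γ`)
        ∃ ρJK : Representation ℂ (BraidGroup n) (JK.W (1 : ℂ) ((q ^ γ : ℝ) : ℂ) n 2),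
          (∀ (i : Fin (n - 1)) (x : JK.W (1 : ℂ) ((q ^ γ : ℝ) : ℂ) n 2),
            (ρJK (braidGen i) x : TPow ℂ n) = JK.sigma (1 : ℂ) ((q ^ γ : ℝ) : ℂ) i x) ∧
          (∃ bW : Module.Basis {p : Fin n × Fin n // p.1 < p.2} ℂ
                (JK.W (1 : ℂ) ((q ^ γ : ℝ) : ℂ) n 2),
            ∀ p, (bW p : TPow ℂ n) = JK.vec (1 : ℂ) ((q ^ γ : ℝ) : ℂ) p.1.1 p.1.2) ∧
          ∃ Φ : ρ.Equiv ρJK,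
            (∀ (i : Fin (n - 1)),
              (Φ (b ⟨(i, i), le_rfl⟩) : TPow ℂ n) =
                (-2 : ℂ) • JK.vec (1 : ℂ) ((q ^ γ : ℝ) : ℂ) (lft i) (rgt i)) ∧
            (∀ (i r : Fin (n - 1)) (h : i ≤ r), (i : ℕ) + 1 = r →
              (Φ (b ⟨(i, r), h⟩) : TPow ℂ n) =
                (((q ^ γ : ℝ) : ℂ)⁻¹) • JK.vec (1 : ℂ) ((q ^ γ : ℝ) : ℂ) (lft i) (rgt i)
                  - JK.vec (1 : ℂ) ((q ^ γ : ℝ) : ℂ) (lft i) (rgt r)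
                  + ((q ^ γ : ℝ) : ℂ) • JK.vec (1 : ℂ) ((q ^ γ : ℝ) : ℂ) (rgt i) (rgt r)) ∧
            (∀ (i r : Fin (n - 1)) (h : i ≤ r), (i : ℕ) + 2 ≤ r →
              (Φ (b ⟨(i, r), h⟩) : TPow ℂ n) =
                - JK.vec (1 : ℂ) ((q ^ γ : ℝ) : ℂ) (lft i) (rgt r)
                  + ((q ^ γ : ℝ) : ℂ) • JK.vec (1 : ℂ) ((q ^ γ : ℝ) : ℂ) (rgt i) (rgt r)
                  + (((q ^ γ : ℝ) : ℂ)⁻¹) • JK.vec (1 : ℂ) ((q ^ γ : ℝ) : ℂ) (lft i) (lft r)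
                  - JK.vec (1 : ℂ) ((q ^ γ : ℝ) : ℂ) (rgt i) (lft r))) ∧
      -- the explicit formulas; `j`, `k` range over indices that are not `i - 1`, `i`, `i + 1`
      (∀ i j k : Fin (n - 1),
        (j : ℕ) + 1 < i ∨ (i : ℕ) + 1 < j → (k : ℕ) + 1 < i ∨ (i : ℕ) + 1 < k →
          HOq.sigmaNorm q γ c i (HOq.w q γ j k) = HOq.w q γ j k) ∧
      (∀ i : Fin (n - 1),
        HOq.sigmaNorm q γ c i (HOq.w q γ i i) =
          ((q ^ (-4 * γ) : ℝ) : ℂ) • HOq.w q γ i i) ∧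
      (∀ i k : Fin (n - 1), (k : ℕ) + 1 < i ∨ (i : ℕ) + 1 < k →
        HOq.sigmaNorm q γ c i (HOq.w q γ i k) =
          (-((q ^ (-2 * γ) : ℝ) : ℂ)) • HOq.w q γ i k ∧
        HOq.sigmaNorm q γ c i (HOq.w q γ k i) =
          (-((q ^ (-2 * γ) : ℝ) : ℂ)) • HOq.w q γ k i) ∧
      (∀ i l k : Fin (n - 1), (l : ℕ) = i + 1 ∨ (l : ℕ) + 1 = i →
        (k : ℕ) + 1 < i ∨ (i : ℕ) + 1 < k →
        HOq.sigmaNorm q γ c i (HOq.w q γ l k) =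
          ((q ^ (-γ) : ℝ) : ℂ) • HOq.w q γ i k + HOq.w q γ l k ∧
        HOq.sigmaNorm q γ c i (HOq.w q γ k l) =
          ((q ^ (-γ) : ℝ) : ℂ) • HOq.w q γ k i + HOq.w q γ k l) ∧
      (∀ i l : Fin (n - 1), (l : ℕ) + 1 = i →
        HOq.sigmaNorm q γ c i (HOq.w q γ l i) =
          (-((q ^ (-2 * γ) : ℝ) : ℂ)) •
            (HOq.w q γ l i + ((q ^ (-γ) : ℝ) : ℂ) • HOq.w q γ i i) ∧
        HOq.sigmaNorm q γ c i (HOq.w q γ l l) =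
          ((q ^ (-2 * γ) : ℝ) : ℂ) • HOq.w q γ i i +
            (2 * ((q ^ (-γ) : ℝ) : ℂ)) • HOq.w q γ l i + HOq.w q γ l l) ∧
      (∀ i r : Fin (n - 1), (r : ℕ) = i + 1 →
        HOq.sigmaNorm q γ c i (HOq.w q γ i r) =
          (-((q ^ (-2 * γ) : ℝ) : ℂ)) •
            (HOq.w q γ i r + ((q ^ (-γ) : ℝ) : ℂ) • HOq.w q γ i i) ∧
        HOq.sigmaNorm q γ c i (HOq.w q γ r r) =
          ((q ^ (-2 * γ) : ℝ) : ℂ) • HOq.w q γ i i +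
            (2 * ((q ^ (-γ) : ℝ) : ℂ)) • HOq.w q γ i r + HOq.w q γ r r) ∧
      (∀ i l r : Fin (n - 1), (l : ℕ) + 1 = i → (r : ℕ) = i + 1 →
        HOq.sigmaNorm q γ c i (HOq.w q γ l r) =
          ((q ^ (-2 * γ) : ℝ) : ℂ) • HOq.w q γ i i +
            ((q ^ (-γ) : ℝ) : ℂ) • (HOq.w q γ l i + HOq.w q γ i r) + HOq.w q γ l r) ∧
      -- the Lawrence–Krammer–Bigelow representation at `(q^{-2γ}, -1)`
      ∃ ρL : Representation ℂ (BraidGroup n) (LKB.Idx n →₀ ℂ),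
        (∀ (i : Fin (n - 1)) (j k : Fin n), j < k →
          ρL (braidGen i) (LKB.v ℂ j k) =
            LKB.gen ((q ^ (-2 * γ) : ℝ) : ℂ) (-1) i j k) ∧
        Nonempty (ρ.Equiv ρL) :=
  mainTheorem6_general n q γ c hq0 hq1.ne hγ
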